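/- Let $d\ge 2$. A finite set $P\subset\mathbb{R}^d$ is in general position if no $d+1$ of its points lie on a common hyperplane. A $(d-1)$-simplex in $P$ is a nondegenerate $(d-1)$-dimensional simplex whose $d$ vertices belong to $P$. Two such simplices strongly cross if their relative interiors intersect and they have no common vertex. A crossing family of size $k$ in $P$ is a set of $k$ pairwise strongly crossing $(d-1)$-simplices in $P$. (i) There is an absolute constant $c>0$ such that every set $P$ of $n\ge 3$ points in general position in $\mathbb{R}^2$ contains a crossing family of size at least $c\sqrt{n}$. (ii) For every $d\ge 3$ there is a constant $c_d>0$, depending only on $d$, such that every set $P$ of $n\ge d+1$ points in general position in $\mathbb{R}^d$ contains a crossing family of size at least $$c_d\, n^{\frac{1}{2\prod_{i=3}^{d}(i^2-i+1)}}.$$ -/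

import Mathlib

/-- A finite point set in `ℝ^d` is in general position if no `d + 1` of its members lie on a common
hyperplane (an affine subspace of dimension `d - 1`). -/
def InGeneralPosition {d : ℕ} (P : Finset (EuclideanSpace ℝ (Fin d))) : Prop :=
  ∀ S : Finset (EuclideanSpace ℝ (Fin d)), S ⊆ P → S.card = d + 1 →
    ¬ ∃ H : AffineSubspace ℝ (EuclideanSpace ℝ (Fin d)),
        (H : Set (EuclideanSpace ℝ (Fin d))).Nonempty ∧
        Module.finrank ℝ H.direction + 1 = d ∧
        (S : Set (EuclideanSpace ℝ (Fin d))) ⊆ H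

/-- Two simplices strongly cross if their (relative) interiors intersect and they have no common
vertex. `Affine.Simplex.interior` is the set of points all of whose barycentric coordinates with
respect to the vertices lie strictly between `0` and `1`. -/
def StronglyCross {d m : ℕ} (s t : Affine.Simplex ℝ (EuclideanSpace ℝ (Fin d)) m) : Prop :=
  (s.interior ∩ t.interior).Nonempty ∧ Disjoint (Set.range s.points) (Set.range t.points)

/-- A crossing family in `P ⊆ ℝ^d`: a finite set of (nondegenerate) `(d - 1)`-dimensional simplices,
all of whose vertices belong to `P`, any two distinct members of which strongly cross. -/
def IsCrossingFamily {d : ℕ} (P : Finset (EuclideanSpace ℝ (Fin d)))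
    (F : Finset (Affine.Simplex ℝ (EuclideanSpace ℝ (Fin d)) (d - 1))) : Prop :=
  (∀ s ∈ F, ∀ i, s.points i ∈ P) ∧ ∀ s ∈ F, ∀ t ∈ F, s ≠ t → StronglyCross s t

/-! The plane is the base case, and the dimension is raised one step at a time by central
projection. Points are indexed by a type `α` with a position map `v`, so that projecting changes
only `v` and vertex sets are kept.

Plane. Cut the points into three vertical strips and halve the two outer ones by a common line. Two
applications of Erdős–Szekeres give two sets of order `√n` points such that every line spanned by
one set has the other set on one side. Paired off in their natural order, such sets span pairwise
crossing segments (`exists_orientedPairs`, `crosses_of_orient`).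

Lifting. In `ℝ^(d+1)`, let a hyperplane separate `A` from `B`, and let no hyperplane spanned by `A`
meet the convex hull of `B`. While a viewpoint moves along a segment between points of `B`, no
degeneracy occurs among the directions to `A`, so vertex-disjoint `d`-subsets of `A` whose cones
cross as seen from one point of `B` have crossing cones as seen from all of these points
(`ViewCrosses.segment`). Project `A` from one point of `B`, take a crossing family there, and cone
each member to its own apex in `B`. The cones cross: a hyperplane separating two of them would meet
the segment between their apexes at a point from which the two bases look separated
(`crosses_insert`).

Finding `A` and `B`. Split the points into halves by a hyperplane and consider all hyperplanes
spanned by the upper half. A cutting (a greedy sample of the hyperplanes, triangulated) has a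
simplex that contains a good share `B` of the lower half and meets few of the hyperplanes
(`exists_low_crossing_subset`). The spanning subsets of those few form a sparse uniform hypergraph,
and a large independent set of it is `A` (`exists_avoiding_pair`).

Balance. In `ℝ^d`, demanding `|A| ≥ m` costs a factor `m ^ (d * (d - 1))` in `|B|`, up to
logarithms. With `n` about `m ^ (d² - d + 1)`, the set `B` still has about `m` points up to
logarithms, while only about `m ^ e` apexes with `e ≤ 1/2` are needed. The logarithms are thus
absorbed, and the exponent is divided by exactly `d² - d + 1`. -/

open Finset

/-! ### Combinatorial form of general position and crossing -/

/-- Any at most `d + 1` of the points `v i`, `i ∈ P`, are affinely independent. -/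
def GenPos {α : Type} {d : ℕ} (v : α → Fin d → ℝ) (P : Finset α) : Prop :=
  ∀ S ⊆ P, S.card ≤ d + 1 → ∀ w : α → ℝ, ∑ i ∈ S, w i = 0 → ∑ i ∈ S, w i • v i = 0 →
    ∀ i ∈ S, w i = 0

/-- The simplices with vertex sets `s` and `t` are vertex-disjoint and some point is a positive
combination of the vertices of each of them. -/
def Crosses {α : Type} {d : ℕ} (v : α → Fin d → ℝ) (s t : Finset α) : Prop :=
  Disjoint s t ∧ ∃ w : α → ℝ, (∀ i ∈ s, 0 < w i) ∧ (∀ i ∈ t, 0 < w i) ∧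
    ∑ i ∈ s, w i = ∑ i ∈ t, w i ∧ ∑ i ∈ s, w i • v i = ∑ i ∈ t, w i • v i

/-- `F` is a family of pairwise crossing `d`-element subsets of `P`. -/
def IsFamily {α : Type} {d : ℕ} (v : α → Fin d → ℝ) (P : Finset α) (F : Finset (Finset α)) :
    Prop :=
  (∀ s ∈ F, s ⊆ P ∧ s.card = d) ∧ ∀ s ∈ F, ∀ t ∈ F, s ≠ t → Crosses v s t

lemma IsFamily.singleton {α : Type} {d : ℕ} (v : α → Fin d → ℝ) {P s : Finset α} (hs : s ⊆ P)
    (hc : s.card = d) : IsFamily v P {s} := by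
  refine ⟨fun t ht => ?_, fun a ha b hb hab => ?_⟩
  · rw [mem_singleton] at ht; subst ht; exact ⟨hs, hc⟩
  · rw [mem_singleton] at ha hb; exact absurd (ha.trans hb.symm) hab

/-! ### Monotone subsets, initial parts and medians -/

/-- The minimal elements form an antichain. If there are fewer than `m`, discard them: the least
element of a chain in the remainder is not minimal in `S`, so some element below it extends the
chain. The least element `t` is carried along for this induction. -/
lemma exists_chain_or_antichain {α : Type} (r : α → α → Prop)
    (htr : ∀ a b c, r a b → r b c → r a c) (hirr : ∀ a, ¬ r a a) (m : ℕ) : ∀ (j : ℕ) (S : Finset α), j * m < S.card →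
    (∃ T ⊆ S, m ≤ T.card ∧ ∀ a ∈ T, ∀ b ∈ T, ¬ r a b) ∨
    (∃ T ⊆ S, j + 1 ≤ T.card ∧ (∀ a ∈ T, ∀ b ∈ T, a ≠ b → r a b ∨ r b a) ∧
      ∃ t ∈ T, ∀ a ∈ T, a = t ∨ r t a) := by
  classical
  intro j
  induction j with
  | zero =>
    intro S hS
    obtain ⟨a, ha⟩ := card_pos.1 (by simpa using hS)
    right
    refine ⟨{a}, by simpa using ha, by simp, ?_, a, by simp, by simp⟩
    intro b hb c hc hbc
    simp only [mem_singleton] at hb hc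
    exact absurd (hb.trans hc.symm) hbc
  | succ j ih =>
    intro S hS
    set M := S.filter (fun a => ∀ b ∈ S, ¬ r b a) with hM
    by_cases hm : m ≤ M.card
    · left
      exact ⟨M, filter_subset _ _, hm, fun a ha b hb => (mem_filter.1 hb).2 a (mem_filter.1 ha).1⟩
    have hMS : M ⊆ S := filter_subset _ _
    have hc : j * m < (S \ M).card := by
      rw [card_sdiff_of_subset hMS]
      have : (j + 1) * m = j * m + m := by ring
      omega
    rcases ih _ hc with ⟨T, hT, h1, h2⟩ | ⟨T, hT, h1, h2, t, ht, h3⟩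
    · exact Or.inl ⟨T, hT.trans sdiff_subset, h1, h2⟩
    · have ht' := mem_sdiff.1 (hT ht)
      have : ∃ b ∈ S, r b t := by
        by_contra hcon
        push Not at hcon
        exact ht'.2 (mem_filter.2 ⟨ht'.1, hcon⟩)
      obtain ⟨b, hb, hbt⟩ := this
      have hall : ∀ a ∈ T, r b a := by
        intro a ha
        rcases h3 a ha with rfl | h
        · exact hbt
        · exact htr _ _ _ hbt h
      have hbb : b ∉ T := fun h => hirr b (hall b h)
      right
      refine ⟨insert b T, insert_subset hb (hT.trans sdiff_subset), ?_, ?_, b, mem_insert_self _ _,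
        ?_⟩
      · rw [card_insert_of_notMem hbb]; omega
      · intro a ha c hc hac
        rw [mem_insert] at ha hc
        rcases ha with rfl | ha
        · rcases hc with rfl | hc
          · exact absurd rfl hac
          · exact Or.inl (hall c hc)
        · rcases hc with rfl | hc
          · exact Or.inr (hall a ha)
          · exact h2 a ha c hc hac
      · intro a ha
        rw [mem_insert] at ha
        exact ha.imp id (hall a)

/-- The Erdős–Szekeres theorem for a finite set carrying two real-valued functions. -/
lemma erdos_szekeres {α : Type} (x θ : α → ℝ) (m : ℕ) (S : Finset α) (hS : m * m ≤ S.card) :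
    ∃ T ⊆ S, m ≤ T.card ∧ ((∀ a ∈ T, ∀ b ∈ T, x a < x b → θ a < θ b) ∨
      (∀ a ∈ T, ∀ b ∈ T, x a < x b → θ b ≤ θ a)) := by
  rcases m with _ | m
  · exact ⟨∅, by simp, by simp, by simp⟩
  rcases exists_chain_or_antichain (fun a b => x a < x b ∧ θ a < θ b)
    (fun a b c h1 h2 => ⟨h1.1.trans h2.1, h1.2.trans h2.2⟩) (fun a h => lt_irrefl _ h.1) (m + 1) m S
    (by nlinarith) with ⟨T, hT, h1, h2⟩ | ⟨T, hT, h1, h2, -⟩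
  · exact ⟨T, hT, h1, Or.inr fun a ha b hb hab => not_lt.1 fun h => h2 a ha b hb ⟨hab, h⟩⟩
  · refine ⟨T, hT, h1, Or.inl fun a ha b hb hab => ?_⟩
    rcases h2 a ha b hb (by rintro rfl; exact lt_irrefl _ hab) with h | h
    · exact h.2
    · exact absurd h.1 hab.not_gt

/-- The `j` elements of `S` with the smallest values of `x`. -/
lemma exists_initial_part {α : Type} (x : α → ℝ) (S : Finset α) (hx : Set.InjOn x S) (j : ℕ)
    (hj : j ≤ S.card) :
    ∃ T ⊆ S, T.card = j ∧ ∀ a ∈ T, ∀ b ∈ S, b ∉ T → x a < x b := by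
  classical
  induction j with
  | zero => exact ⟨∅, by simp, by simp, by simp⟩
  | succ j ih =>
    obtain ⟨T, hT, hc, h⟩ := ih (by omega)
    have hne : (S \ T).Nonempty := by
      rw [← card_pos, card_sdiff_of_subset hT]; omega
    obtain ⟨c, hcS, hmin⟩ := exists_min_image (S \ T) x hne
    have hc' := mem_sdiff.1 hcS
    refine ⟨insert c T, insert_subset hc'.1 hT, by rw [card_insert_of_notMem hc'.2, hc], ?_⟩
    intro a ha b hb hbn
    rw [mem_insert, not_or] at hbn
    rw [mem_insert] at ha
    rcases ha with rfl | ha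
    · refine lt_of_le_of_ne (hmin b (mem_sdiff.2 ⟨hb, hbn.2⟩)) fun he => hbn.1 ?_
      exact (hx hc'.1 hb he).symm
    · exact h a ha b hb hbn.2

/-- A weak median. -/
lemma exists_median {α : Type} (h : α → ℝ) (S : Finset α) (k : ℕ) (hS : 2 * k + 1 ≤ S.card) :
    ∃ s ∈ S, k + 1 ≤ (S.filter fun a => h a ≤ h s).card ∧
      k + 1 ≤ (S.filter fun a => h s ≤ h a).card := by
  classical
  have hne : (S.filter fun s => k + 1 ≤ (S.filter fun a => h a ≤ h s).card).Nonempty := by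
    obtain ⟨s, hs, hm⟩ := exists_max_image S h (card_pos.1 (by omega))
    refine ⟨s, mem_filter.2 ⟨hs, ?_⟩⟩
    rw [filter_true_of_mem hm]; omega
  obtain ⟨s, hs, hmin⟩ := exists_min_image _ h hne
  have hs' := mem_filter.1 hs
  refine ⟨s, hs'.1, hs'.2, ?_⟩
  have hlt : (S.filter fun a => ¬ h s ≤ h a).card ≤ k := by
    by_contra hcon
    obtain ⟨t, ht, hmax⟩ := exists_max_image (S.filter fun a => ¬ h s ≤ h a) h
      (card_pos.1 (by omega))
    have ht' := mem_filter.1 ht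
    refine ht'.2 (hmin t (mem_filter.2 ⟨ht'.1, ?_⟩))
    refine le_trans (by omega : k + 1 ≤ _) (card_le_card (s := S.filter fun a => ¬ h s ≤ h a) ?_)
    intro a ha
    exact mem_filter.2 ⟨(mem_filter.1 ha).1, hmax a ha⟩
  have := card_filter_add_card_filter_not (s := S) (fun a => h s ≤ h a)
  omega

/-! ### The planar case -/

/-- Twice the signed area of the triangle `i j k`. -/
def orient {α : Type} (x y : α → ℝ) (i j k : α) : ℝ :=
  (x j - x i) * (y k - y i) - (y j - y i) * (x k - x i)

lemma orient_neg {α : Type} (x y : α → ℝ) (i j k : α) :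
    orient x (fun a => - y a) i j k = - orient x y i j k := by
  unfold orient; ring

/-- Through every point of `L` passes a line halving `R`; take one of median height at the abscissa
`ξ`. None of these lines is strictly above another over all of `R`. Hence a point of `L` whose line
is at least as high at `ξ` cannot lie below the chosen line, which would force its line to be
steeper and strictly higher over `R`; symmetrically for lower lines. -/
lemma exists_halving_line {α : Type} (x y : α → ℝ) (L R : Finset α) (k : ℕ) (ξ : ℝ)
    (hL : ∀ a ∈ L, x a < ξ) (hR : ∀ b ∈ R, ξ < x b) (hLc : 2 * k + 1 ≤ L.card)
    (hRc : R.card = 2 * k + 1) :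
    ∃ p q : ℝ, k + 1 ≤ (L.filter fun a => p * x a + q ≤ y a).card ∧
      k + 1 ≤ (L.filter fun a => y a ≤ p * x a + q).card ∧
      k + 1 ≤ (R.filter fun a => p * x a + q ≤ y a).card ∧
      k + 1 ≤ (R.filter fun a => y a ≤ p * x a + q).card := by
  classical
  have key : ∀ l ∈ L, ∃ p : ℝ,
      k + 1 ≤ (R.filter fun a => p * (x a - x l) + y l ≤ y a).card ∧
      k + 1 ≤ (R.filter fun a => y a ≤ p * (x a - x l) + y l).card := by
    intro l hl
    obtain ⟨r, hr, h1, h2⟩ := exists_median (fun b => (y b - y l) / (x b - x l)) R k hRc.ge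
    refine ⟨(y r - y l) / (x r - x l), h2.trans (card_le_card ?_), h1.trans (card_le_card ?_)⟩
    · intro b hb
      rw [mem_filter] at hb ⊢
      have hpos : 0 < x b - x l := by linarith [hL l hl, hR b hb.1]
      have := (le_div_iff₀ hpos).1 hb.2
      exact ⟨hb.1, by linarith⟩
    · intro b hb
      rw [mem_filter] at hb ⊢
      have hpos : 0 < x b - x l := by linarith [hL l hl, hR b hb.1]
      have := (div_le_iff₀ hpos).1 hb.2
      exact ⟨hb.1, by linarith⟩
  choose! p hp1 hp2 using key
  obtain ⟨l, hl, h1, h2⟩ := exists_median (fun l => p l * (ξ - x l) + y l) L k hLc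
  -- Two closed halves, each with at least `k + 1` of the `2 * k + 1` points of `R`, share a point.
  have meet : ∀ a ∈ L, ∀ a' ∈ L, ∃ b ∈ R, p a * (x b - x a) + y a ≤ y b ∧
      y b ≤ p a' * (x b - x a') + y a' := by
    intro a ha a' ha'
    by_contra hcon
    push Not at hcon
    have hd : Disjoint (R.filter fun b => p a * (x b - x a) + y a ≤ y b)
        (R.filter fun b => y b ≤ p a' * (x b - x a') + y a') := by
      rw [disjoint_left]
      intro b hb hb'
      rw [mem_filter] at hb hb'
      exact absurd hb'.2 (not_le.2 (hcon b hb.1 hb.2))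
    have h3 := card_union_of_disjoint hd
    have h4 := card_le_card (union_subset (filter_subset (fun b => p a * (x b - x a) + y a ≤ y b) R)
      (filter_subset (fun b => y b ≤ p a' * (x b - x a') + y a') R))
    have := hp1 a ha
    have := hp2 a' ha'
    omega
  have eqn : ∀ t, p l * t + (y l - p l * x l) = p l * (t - x l) + y l := fun t => by ring
  refine ⟨p l, y l - p l * x l, ?_, ?_, ?_, ?_⟩
  · refine h2.trans (card_le_card ?_)
    intro a ha
    rw [mem_filter] at ha ⊢
    refine ⟨ha.1, ?_⟩
    rw [eqn]
    by_contra hcon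
    push Not at hcon
    obtain ⟨b, hb, h3, h4⟩ := meet a ha.1 l hl
    have h5 := hL a ha.1
    have h6 := hR b hb
    have hs : 0 < p a - p l := by
      by_contra hn
      push Not at hn
      nlinarith [mul_nonneg (neg_nonneg.2 hn) (sub_nonneg.2 h5.le), ha.2]
    nlinarith [mul_pos hs (sub_pos.2 h6), ha.2]
  · refine h1.trans (card_le_card ?_)
    intro a ha
    rw [mem_filter] at ha ⊢
    refine ⟨ha.1, ?_⟩
    rw [eqn]
    by_contra hcon
    push Not at hcon
    obtain ⟨b, hb, h3, h4⟩ := meet l hl a ha.1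
    have h5 := hL a ha.1
    have h6 := hR b hb
    have hs : 0 < p l - p a := by
      by_contra hn
      push Not at hn
      nlinarith [mul_nonneg (neg_nonneg.2 hn) (sub_nonneg.2 h5.le), ha.2]
    nlinarith [mul_pos hs (sub_pos.2 h6), ha.2]
  · simpa only [eqn] using hp1 l hl
  · simpa only [eqn] using hp2 l hl

/-- Apply Erdős–Szekeres to the slopes from points of `A` to the point of the line at abscissa `ξ`.
If they increase, a line through two selected points passes below that point, hence below the given
line to the right of `ξ`, and `B` is above it. Otherwise it stays weakly above the given line up to
`ξ`, and `C` is below it. -/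
lemma exists_subset_avoiding_one_of_two {α : Type} (x y : α → ℝ) (A B C : Finset α) (m : ℕ)
    (p q ξ : ℝ)
    (hA : ∀ a ∈ A, p * x a + q ≤ y a) (hB : ∀ b ∈ B, p * x b + q ≤ y b)
    (hC : ∀ c ∈ C, y c ≤ p * x c + q)
    (hAC : ∀ a ∈ A, ∀ c ∈ C, x a < x c) (hCξ : ∀ c ∈ C, x c < ξ) (hAξ : ∀ a ∈ A, x a < ξ)
    (hξB : ∀ b ∈ B, ξ < x b) (hm : m * m ≤ A.card) :
    ∃ A' ⊆ A, m ≤ A'.card ∧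
      ((∀ a ∈ A', ∀ a' ∈ A', x a < x a' → ∀ b ∈ B, 0 ≤ orient x y a a' b) ∨
       (∀ a ∈ A', ∀ a' ∈ A', x a < x a' → ∀ c ∈ C, orient x y a a' c ≤ 0)) := by
  obtain ⟨T, hT, hc, h⟩ := erdos_szekeres x (fun a => (p * ξ + q - y a) / (ξ - x a)) m A hm
  refine ⟨T, hT, hc, ?_⟩
  rcases h with h | h
  · left
    intro a ha a' ha' haa b hb
    have hX := sub_pos.2 (hAξ a (hT ha))
    have hX' := sub_pos.2 (hAξ a' (hT ha'))
    have h1 := (div_lt_div_iff₀ hX hX').1 (h a ha a' ha' haa)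
    have h2 := hA a (hT ha)
    have h4 := hB b hb
    have h5 := hξB b hb
    -- The three summands are nonnegative by the height of `b`, the order of the slopes and the
    -- height of `a`, respectively.
    have e : (ξ - x a) * orient x y a a' b =
        (ξ - x a) * (x a' - x a) * (y b - (p * x b + q)) +
        (x b - x a) * ((p * ξ + q - y a') * (ξ - x a) - (p * ξ + q - y a) * (ξ - x a')) +
        (x b - ξ) * ((x a' - x a) * (y a - (p * x a + q))) := by
      unfold orient; ring
    have : 0 ≤ (ξ - x a) * orient x y a a' b := by
      rw [e]
      have := mul_nonneg (mul_nonneg hX.le (sub_pos.2 haa).le) (sub_nonneg.2 h4)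
      have := mul_nonneg (show 0 ≤ x b - x a by linarith) (sub_pos.2 h1).le
      have := mul_nonneg (sub_pos.2 h5).le (mul_nonneg (sub_pos.2 haa).le (sub_nonneg.2 h2))
      linarith
    exact nonneg_of_mul_nonneg_right this hX
  · right
    intro a ha a' ha' haa c hc
    have hX := sub_pos.2 (hAξ a (hT ha))
    have hX' := sub_pos.2 (hAξ a' (hT ha'))
    have h1 := (div_le_div_iff₀ hX' hX).1 (h a ha a' ha' haa)
    have h2 := hA a (hT ha)
    have h4 := hC c hc
    have h5 := hCξ c hc
    have h6 := hAC a (hT ha) c hc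
    have e : (ξ - x a) * -orient x y a a' c =
        (ξ - x a) * (x a' - x a) * (p * x c + q - y c) +
        (x c - x a) * ((p * ξ + q - y a) * (ξ - x a') - (p * ξ + q - y a') * (ξ - x a)) +
        (ξ - x c) * ((x a' - x a) * (y a - (p * x a + q))) := by
      unfold orient; ring
    have : 0 ≤ (ξ - x a) * -orient x y a a' c := by
      rw [e]
      have := mul_nonneg (mul_nonneg hX.le (sub_pos.2 haa).le) (sub_nonneg.2 h4)
      have := mul_nonneg (sub_pos.2 h6).le (sub_nonneg.2 h1)
      have := mul_nonneg (sub_pos.2 h5).le (mul_nonneg (sub_pos.2 haa).le (sub_nonneg.2 h2))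
      linarith
    have := nonneg_of_mul_nonneg_right this hX
    linarith

lemma exists_increasing_enum {α : Type} (x : α → ℝ) (S : Finset α) (hx : Set.InjOn x S) (k : ℕ)
    (hk : k ≤ S.card) :
    ∃ a : Fin k → α, (∀ i, a i ∈ S) ∧ ∀ i j, i < j → x (a i) < x (a j) := by
  classical
  have hc : k ≤ (S.image x).card := by rwa [card_image_of_injOn hx]
  have : ∀ i : Fin k, ∃ a ∈ S, x a = (S.image x).orderEmbOfCardLe hc i := fun i => by
    have := (S.image x).orderEmbOfCardLe_mem hc i
    rwa [mem_image] at this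
  choose a ha h using this
  refine ⟨a, ha, fun i j hij => ?_⟩
  rw [h, h]
  exact (OrderEmbedding.lt_iff_lt _).2 hij

/-- Choose `p` in `A` with at least `k` points of `A` on each side, and `k` points of `B` whose
slopes seen from `p` are monotone. If the slopes increase, lines spanned by these points pass below
`p`, hence below the points of `A` to its left. Otherwise the lines pass weakly above `p`, hence
above the points of `A` to its right, and the points of `B` are enumerated from right to left to
make the orientations agree. -/
lemma exists_mutually_avoiding_enum {α : Type} (x y : α → ℝ) (A B : Finset α) (k : ℕ)
    (hxA : Set.InjOn x A) (hxB : Set.InjOn x B) (hAB : ∀ a ∈ A, ∀ b ∈ B, x a < x b)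
    (h : ∀ a ∈ A, ∀ a' ∈ A, x a < x a' → ∀ b ∈ B, 0 < orient x y a a' b)
    (hAk : 2 * k + 1 ≤ A.card) (hBk : k * k ≤ B.card) :
    ∃ a b : Fin k → α, (∀ i, a i ∈ A) ∧ (∀ i, b i ∈ B) ∧ ∀ i j, i < j →
      0 < orient x y (a i) (a j) (b i) ∧ 0 < orient x y (a i) (a j) (b j) ∧
      0 < orient x y (b i) (b j) (a i) ∧ 0 < orient x y (b i) (b j) (a j) := by
  classical
  obtain ⟨A1, hA1, hc1, hlt1⟩ := exists_initial_part x A hxA k (by omega)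
  have hcs : (A \ A1).card = A.card - k := by rw [card_sdiff_of_subset hA1, hc1]
  obtain ⟨p, hp, hmin⟩ := exists_min_image (A \ A1) x (card_pos.1 (by omega))
  have hpA := mem_sdiff.1 hp
  set A2 := (A \ A1).erase p with hA2
  have hc2 : k ≤ A2.card := by rw [card_erase_of_mem hp]; omega
  have hA2A : A2 ⊆ A := (erase_subset _ _).trans sdiff_subset
  have hlt2 : ∀ a ∈ A2, x p < x a := by
    intro a ha
    have ha' := mem_erase.1 ha
    exact lt_of_le_of_ne (hmin a ha'.2) fun he => ha'.1 (hxA hpA.1 (hA2A ha) he).symm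
  have hlt1' : ∀ a ∈ A1, x a < x p := fun a ha => hlt1 a ha p hpA.1 hpA.2
  obtain ⟨B', hB', hcB, hmono⟩ := erdos_szekeres x (fun b => (y b - y p) / (x b - x p)) k B hBk
  have hbp : ∀ b ∈ B', 0 < x b - x p := fun b hb => sub_pos.2 (hAB p hpA.1 b (hB' hb))
  obtain ⟨b, hb, hbinc⟩ := exists_increasing_enum x B' (hxB.mono hB') k hcB
  rcases hmono with hm | hm
  · have hall : ∀ a ∈ A1, ∀ b ∈ B', ∀ b' ∈ B', x b < x b' → 0 < orient x y b b' a := by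
      intro a ha b hb b' hb' hbb
      have h1 := (div_lt_div_iff₀ (hbp b hb) (hbp b' hb')).1 (hm b hb b' hb' hbb)
      have h2 := h a (hA1 ha) p hpA.1 (hlt1' a ha) b (hB' hb)
      have h3 := hlt1' a ha
      have h4 := hbp b hb
      have e : (x b - x p) * orient x y b b' a = (x b' - x b) * orient x y a p b +
          (x b - x a) * ((y b' - y p) * (x b - x p) - (y b - y p) * (x b' - x p)) := by
        unfold orient; ring
      have : 0 < (x b - x p) * orient x y b b' a := by
        rw [e]
        have := mul_pos (sub_pos.2 hbb) h2
        have := mul_pos (show 0 < x b - x a by linarith) (sub_pos.2 h1)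
        linarith
      exact (pos_iff_pos_of_mul_pos this).1 h4
    obtain ⟨a, ha, hainc⟩ := exists_increasing_enum x A1 (hxA.mono hA1) k hc1.ge
    refine ⟨a, b, fun i => hA1 (ha i), fun i => hB' (hb i), fun i j hij => ?_⟩
    exact ⟨h _ (hA1 (ha i)) _ (hA1 (ha j)) (hainc i j hij) _ (hB' (hb i)),
      h _ (hA1 (ha i)) _ (hA1 (ha j)) (hainc i j hij) _ (hB' (hb j)),
      hall _ (ha i) _ (hb i) _ (hb j) (hbinc i j hij),
      hall _ (ha j) _ (hb i) _ (hb j) (hbinc i j hij)⟩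
  · have hall : ∀ a ∈ A2, ∀ b ∈ B', ∀ b' ∈ B', x b < x b' → 0 < orient x y b' b a := by
      intro a ha b hb b' hb' hbb
      have h1 := (div_le_div_iff₀ (hbp b' hb') (hbp b hb)).1 (hm b hb b' hb' hbb)
      have h2 := h p hpA.1 a (hA2A ha) (hlt2 a ha) b (hB' hb)
      have h3 := hlt2 a ha
      have h4 := hbp b hb
      have h5 := hAB a (hA2A ha) b (hB' hb)
      have e : (x b - x p) * orient x y b' b a = (x b' - x b) * orient x y p a b +
          (x b - x a) * ((y b - y p) * (x b' - x p) - (y b' - y p) * (x b - x p)) := by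
        unfold orient; ring
      have : 0 < (x b - x p) * orient x y b' b a := by
        rw [e]
        have := mul_pos (sub_pos.2 hbb) h2
        have := mul_nonneg (show 0 ≤ x b - x a by linarith) (sub_nonneg.2 h1)
        linarith
      exact (pos_iff_pos_of_mul_pos this).1 h4
    obtain ⟨a, ha, hainc⟩ := exists_increasing_enum x A2 (hxA.mono hA2A) k hc2
    refine ⟨a, fun i => b i.rev, fun i => hA2A (ha i), fun i => hB' (hb _), fun i j hij => ?_⟩
    have hr : j.rev < i.rev := Fin.rev_lt_rev.2 hij
    exact ⟨h _ (hA2A (ha i)) _ (hA2A (ha j)) (hainc i j hij) _ (hB' (hb _)),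
      h _ (hA2A (ha i)) _ (hA2A (ha j)) (hainc i j hij) _ (hB' (hb _)),
      hall _ (ha i) _ (hb _) _ (hb _) (hbinc _ _ hr),
      hall _ (ha j) _ (hb _) _ (hb _) (hbinc _ _ hr)⟩

/-- Enumerated pairs `a i, b i` whose segments cross pairwise in a consistently oriented way. -/
def HasOrientedPairs {α : Type} (x y : α → ℝ) (P : Finset α) (k : ℕ) : Prop :=
  ∃ a b : Fin k → α, (∀ i, a i ∈ P) ∧ (∀ i, b i ∈ P) ∧ (∀ i j, x (a i) < x (b j)) ∧
    ∀ i j, i < j →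
      0 < orient x y (a i) (a j) (b i) ∧ 0 < orient x y (a i) (a j) (b j) ∧
      0 < orient x y (b i) (b j) (a i) ∧ 0 < orient x y (b i) (b j) (a j)

lemma exists_orientedPairs_of_halving {α : Type} (x y : α → ℝ) (P A B C : Finset α)
    (hx : Set.InjOn x P)
    (ho : ∀ a ∈ P, ∀ b ∈ P, ∀ c ∈ P, a ≠ b → a ≠ c → b ≠ c → orient x y a b c ≠ 0)
    (hAP : A ⊆ P) (hBP : B ⊆ P) (hCP : C ⊆ P) (k : ℕ) (p q ξ : ℝ)
    (hA : ∀ a ∈ A, p * x a + q ≤ y a) (hB : ∀ b ∈ B, p * x b + q ≤ y b)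
    (hC : ∀ c ∈ C, y c ≤ p * x c + q)
    (hAC : ∀ a ∈ A, ∀ c ∈ C, x a < x c) (hCξ : ∀ c ∈ C, x c < ξ) (hAξ : ∀ a ∈ A, x a < ξ)
    (hξB : ∀ b ∈ B, ξ < x b) (hAc : (2 * k + 1) * (2 * k + 1) ≤ A.card) (hBc : k * k ≤ B.card)
    (hCc : k * k ≤ C.card) :
    HasOrientedPairs x y P k ∨ HasOrientedPairs x (fun i => - y i) P k := by
  obtain ⟨A', hA', hc, h⟩ :=
    exists_subset_avoiding_one_of_two x y A B C _ p q ξ hA hB hC hAC hCξ hAξ hξB hAc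
  have hA'P := hA'.trans hAP
  rcases h with h | h
  · left
    have hlt : ∀ a ∈ A', ∀ b ∈ B, x a < x b :=
      fun a ha b hb => (hAξ a (hA' ha)).trans (hξB b hb)
    obtain ⟨a, b, ha, hb, hab⟩ := exists_mutually_avoiding_enum x y A' B k (hx.mono hA'P)
      (hx.mono hBP) hlt
      (fun a ha a' ha' haa b hb => lt_of_le_of_ne (h a ha a' ha' haa b hb)
        (ho a (hA'P ha) a' (hA'P ha') b (hBP hb) (by rintro rfl; exact lt_irrefl _ haa)
          (by rintro rfl; exact lt_irrefl _ (hlt _ ha _ hb))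
          (by rintro rfl; exact lt_irrefl _ (hlt _ ha' _ hb))).symm) hc hBc
    exact ⟨a, b, fun i => hA'P (ha i), fun i => hBP (hb i), fun i j => hlt _ (ha i) _ (hb j), hab⟩
  · right
    have hlt : ∀ a ∈ A', ∀ b ∈ C, x a < x b := fun a ha b hb => hAC a (hA' ha) b hb
    obtain ⟨a, b, ha, hb, hab⟩ := exists_mutually_avoiding_enum x (fun i => - y i) A' C k
      (hx.mono hA'P) (hx.mono hCP) hlt
      (fun a ha a' ha' haa b hb => by
        rw [orient_neg, neg_pos]
        exact lt_of_le_of_ne (h a ha a' ha' haa b hb)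
          (ho a (hA'P ha) a' (hA'P ha') b (hCP hb) (by rintro rfl; exact lt_irrefl _ haa)
            (by rintro rfl; exact lt_irrefl _ (hlt _ ha _ hb))
            (by rintro rfl; exact lt_irrefl _ (hlt _ ha' _ hb)))) hc hCc
    exact ⟨a, b, fun i => hA'P (ha i), fun i => hCP (hb i), fun i j => hlt _ (ha i) _ (hb j), hab⟩

/-- Let a line halve both the left and the right strip. One of its closed sides contains half of the
middle strip; the points of the outer strips on the opposite side serve as `A` and `B`, those of the
middle strip as `C`. The reflection `y ↦ -y` exchanges the two cases. -/
lemma exists_orientedPairs {α : Type} (x y : α → ℝ) (P : Finset α)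
    (hx : Set.InjOn x P)
    (ho : ∀ a ∈ P, ∀ b ∈ P, ∀ c ∈ P, a ≠ b → a ≠ c → b ≠ c → orient x y a b c ≠ 0)
    (k m : ℕ) (hk : (2 * k + 1) * (2 * k + 1) ≤ m + 1) (hP : 6 * m + 3 ≤ P.card) :
    HasOrientedPairs x y P k ∨ HasOrientedPairs x (fun i => - y i) P k := by
  classical
  obtain ⟨LM, hLM, hLMc, hLMR⟩ := exists_initial_part x P hx (4 * m + 2) (by omega)
  obtain ⟨L, hL, hLc, hLltM⟩ := exists_initial_part x LM (hx.mono hLM) (2 * m + 1) (by omega)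
  have hcR : 2 * m + 1 ≤ (P \ LM).card := by rw [card_sdiff_of_subset hLM]; omega
  obtain ⟨R, hR, hRc⟩ := exists_subset_card_eq hcR
  set M := LM \ L with hM
  have hMc : M.card = 2 * m + 1 := by rw [card_sdiff_of_subset hL]; omega
  have hMLM : M ⊆ LM := sdiff_subset
  have hlt : ∀ a ∈ LM, ∀ b ∈ R, x a < x b := fun a ha b hb =>
    hLMR a ha b (mem_sdiff.1 (hR hb)).1 (mem_sdiff.1 (hR hb)).2
  obtain ⟨u, hu, hmax⟩ := exists_max_image LM x (card_pos.1 (by omega))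
  obtain ⟨r, hr, hmin⟩ := exists_min_image R x (card_pos.1 (by omega))
  obtain ⟨ξ, h1, h2⟩ := exists_between (hlt u hu r hr)
  have hLMξ : ∀ a ∈ LM, x a < ξ := fun a ha => (hmax a ha).trans_lt h1
  have hξR : ∀ b ∈ R, ξ < x b := fun b hb => h2.trans_le (hmin b hb)
  obtain ⟨p, q, g1, g2, g3, g4⟩ := exists_halving_line x y L R m ξ (fun a ha => hLMξ a (hL ha)) hξR
    hLc.ge hRc
  have hkk : k * k ≤ m + 1 := by nlinarith
  have hRP : R ⊆ P := hR.trans sdiff_subset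
  have hLP := hL.trans hLM
  have hMP := hMLM.trans hLM
  have hLM' : ∀ a ∈ L, ∀ c ∈ M, x a < x c := fun a ha c hc =>
    hLltM a ha c (hMLM hc) (mem_sdiff.1 hc).2
  by_cases hcase : m + 1 ≤ (M.filter fun a => y a ≤ p * x a + q).card
  · exact exists_orientedPairs_of_halving x y P (L.filter fun a => p * x a + q ≤ y a)
      (R.filter fun a => p * x a + q ≤ y a) (M.filter fun a => y a ≤ p * x a + q) hx ho
      ((filter_subset _ _).trans hLP) ((filter_subset _ _).trans hRP) ((filter_subset _ _).trans hMP)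
      k p q ξ (fun a ha => (mem_filter.1 ha).2) (fun a ha => (mem_filter.1 ha).2)
      (fun a ha => (mem_filter.1 ha).2)
      (fun a ha c hc => hLM' a (mem_filter.1 ha).1 c (mem_filter.1 hc).1)
      (fun c hc => hLMξ c (hMLM (mem_filter.1 hc).1)) (fun a ha => hLMξ a (hL (mem_filter.1 ha).1))
      (fun b hb => hξR b (mem_filter.1 hb).1) (hk.trans g1) (hkk.trans g3) (hkk.trans hcase)
  · have hcase' : m + 1 ≤ (M.filter fun a => p * x a + q ≤ y a).card := by
      have h3 := card_filter_add_card_filter_not (s := M) (fun a => y a ≤ p * x a + q)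
      have h4 : (M.filter fun a => ¬ y a ≤ p * x a + q).card ≤
          (M.filter fun a => p * x a + q ≤ y a).card := by
        refine card_le_card fun a ha => ?_
        rw [mem_filter] at ha ⊢
        exact ⟨ha.1, (not_le.1 ha.2).le⟩
      omega
    have := exists_orientedPairs_of_halving x (fun i => - y i) P
      (L.filter fun a => y a ≤ p * x a + q)
      (R.filter fun a => y a ≤ p * x a + q) (M.filter fun a => p * x a + q ≤ y a) hx
      (fun a ha b hb c hc h1 h2 h3 => by
        rw [orient_neg, neg_ne_zero]; exact ho a ha b hb c hc h1 h2 h3)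
      ((filter_subset _ _).trans hLP) ((filter_subset _ _).trans hRP) ((filter_subset _ _).trans hMP)
      k (-p) (-q) ξ (fun a ha => by have := (mem_filter.1 ha).2; linarith)
      (fun a ha => by have := (mem_filter.1 ha).2; linarith)
      (fun a ha => by have := (mem_filter.1 ha).2; linarith)
      (fun a ha c hc => hLM' a (mem_filter.1 ha).1 c (mem_filter.1 hc).1)
      (fun c hc => hLMξ c (hMLM (mem_filter.1 hc).1)) (fun a ha => hLMξ a (hL (mem_filter.1 ha).1))
      (fun b hb => hξR b (mem_filter.1 hb).1) (hk.trans g2) (hkk.trans g4) (hkk.trans hcase')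
    simpa only [neg_neg, or_comm] using this

/-- The signs make `a, a', b, b'` a convex quadrilateral in this cyclic order, with diagonals `ab`
and `a'b'`. By Cramer's rule the weight of each vertex is twice the area of the triangle on the
other three. The coordinates may be sheared by `r` and scaled by `s`, which allows distinct
abscissae and reflections. -/
lemma crosses_of_orient {α : Type} [DecidableEq α] (v : α → Fin 2 → ℝ) (x y : α → ℝ) (s : ℝ)
    (hs : s ≠ 0) (hy : ∀ i, y i = s * v i 1) (r : ℝ) (hx : ∀ i, x i = v i 0 + r * v i 1)
    (a b a' b' : α) (hab : a ≠ b) (hab' : a' ≠ b')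
    (haa' : a ≠ a') (hab'' : a ≠ b') (hba' : b ≠ a') (hbb' : b ≠ b')
    (h1 : 0 < orient x y a a' b) (h2 : 0 < orient x y a a' b')
    (h3 : 0 < orient x y b b' a) (h4 : 0 < orient x y b b' a') :
    Crosses v {a, b} {a', b'} := by
  refine ⟨?_, fun i => if i = a then orient x y b b' a' else if i = a' then orient x y b b' a else
    if i = b then orient x y a a' b' else orient x y a a' b, ?_, ?_, ?_, ?_⟩
  · simp [haa'.symm, hab''.symm, hba'.symm, hbb'.symm]
  · intro i hi
    dsimp only
    split_ifs <;> assumption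
  · intro i hi
    dsimp only
    split_ifs <;> assumption
  · rw [sum_pair hab, sum_pair hab']
    simp only [if_true, if_neg hab.symm, if_neg hba', if_neg haa'.symm, if_neg hab''.symm,
      if_neg hab'.symm, if_neg hbb'.symm]
    unfold orient; ring
  · rw [sum_pair hab, sum_pair hab']
    simp only [if_true, if_neg hab.symm, if_neg hba', if_neg haa'.symm, if_neg hab''.symm,
      if_neg hab'.symm, if_neg hbb'.symm]
    have e1 : orient x y b b' a' * v a 1 + orient x y a a' b' * v b 1 =
        orient x y b b' a * v a' 1 + orient x y a a' b * v b' 1 := by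
      apply mul_left_cancel₀ hs
      simp only [orient, hy]; ring
    ext i
    fin_cases i
    · have e2 : orient x y b b' a' * x a + orient x y a a' b' * x b =
          orient x y b b' a * x a' + orient x y a a' b * x b' := by
        simp only [orient]; ring
      simp only [hx] at e2
      simp only [Fin.zero_eta, Fin.isValue, Pi.add_apply, Pi.smul_apply, smul_eq_mul]
      linear_combination e2 - r * e1
    · simpa using e1

lemma Crosses.symm {α : Type} {d : ℕ} {v : α → Fin d → ℝ} {s t : Finset α} (h : Crosses v s t) :
    Crosses v t s := by
  obtain ⟨h1, w, h2, h3, h4, h5⟩ := h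
  exact ⟨h1.symm, w, h3, h2, h4.symm, h5.symm⟩

lemma exists_family_of_orientedPairs {α : Type} (v : α → Fin 2 → ℝ) (x y : α → ℝ) (s : ℝ)
    (hs : s ≠ 0) (hy : ∀ i, y i = s * v i 1) (r : ℝ) (hx : ∀ i, x i = v i 0 + r * v i 1)
    (P : Finset α) (k : ℕ) (h : HasOrientedPairs x y P k) :
    ∃ F, IsFamily v P F ∧ F.card = k := by
  classical
  obtain ⟨a, b, ha, hb, hab, ho⟩ := h
  have hab' : ∀ i j, a i ≠ b j := fun i j he => lt_irrefl (x (a i)) (by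
    conv_rhs => rw [he]
    exact hab i j)
  have hne : ∀ i j, i < j → a i ≠ a j ∧ b i ≠ b j := by
    intro i j hij
    have h1 := ho i j hij
    constructor
    · intro he; have := h1.1; rw [he] at this; simp [orient] at this
    · intro he; have := h1.2.2.1; rw [he] at this; simp [orient] at this
  have hcross : ∀ i j, i < j → Crosses v {a i, b i} {a j, b j} := by
    intro i j hij
    obtain ⟨h1, h2, h3, h4⟩ := ho i j hij
    exact crosses_of_orient v x y s hs hy r hx _ _ _ _ (hab' i i) (hab' j j) (hne i j hij).1
      (hab' i j) (hab' j i).symm (hne i j hij).2 h1 h2 h3 h4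
  have hc : ∀ i j, i ≠ j → Crosses v {a i, b i} {a j, b j} := by
    intro i j hij
    rcases lt_or_gt_of_ne hij with h | h
    · exact hcross i j h
    · exact (hcross j i h).symm
  refine ⟨univ.image fun i => {a i, b i}, ⟨?_, ?_⟩, ?_⟩
  · intro s hs
    obtain ⟨i, -, rfl⟩ := mem_image.1 hs
    exact ⟨by simp [insert_subset_iff, ha, hb], card_pair (hab' i i)⟩
  · intro s hs t ht hst
    obtain ⟨i, -, rfl⟩ := mem_image.1 hs
    obtain ⟨j, -, rfl⟩ := mem_image.1 ht
    exact hc i j (by rintro rfl; exact hst rfl)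
  · rw [card_image_of_injective, card_univ, Fintype.card_fin]
    intro i j hij
    by_contra hne
    have := (hc i j hne).1
    dsimp only at hij
    rw [hij, disjoint_self_iff_empty] at this
    simp at this

lemma exists_shear {α : Type} (v : α → Fin 2 → ℝ) (P : Finset α) (hv : Set.InjOn v P) :
    ∃ r : ℝ, Set.InjOn (fun i => v i 0 + r * v i 1) P := by
  classical
  obtain ⟨r, hr⟩ := Infinite.exists_notMem_finset
    ((P ×ˢ P).image fun ij => -(v ij.1 0 - v ij.2 0) / (v ij.1 1 - v ij.2 1))
  refine ⟨r, fun i hi j hj hij => hv hi hj ?_⟩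
  dsimp only at hij
  by_cases h : v i 1 - v j 1 = 0
  · have h1 : v i 1 = v j 1 := by linarith
    rw [h1] at hij
    ext l
    fin_cases l
    · simpa using hij
    · exact h1
  · exfalso
    refine hr (mem_image.2 ⟨(i, j), mem_product.2 ⟨hi, hj⟩, ?_⟩)
    dsimp only
    rw [div_eq_iff h]
    linarith

lemma GenPos.injOn {α : Type} {d : ℕ} (hd : 1 ≤ d) {v : α → Fin d → ℝ} {P : Finset α}
    (h : GenPos v P) : Set.InjOn v P := by
  classical
  intro i hi j hj hij
  by_contra hne
  have := h {i, j} (by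
    intro a ha
    simp only [mem_insert, mem_singleton] at ha
    rcases ha with rfl | rfl
    · exact hi
    · exact hj) (by rw [card_pair hne]; omega) (fun a => if a = i then 1 else -1)
    (by rw [sum_pair hne, if_pos rfl, if_neg (Ne.symm hne)]; norm_num)
    (by rw [sum_pair hne, if_pos rfl, if_neg (Ne.symm hne), hij]; simp) i (by simp)
  simp at this

lemma GenPos.orient_ne_zero {α : Type} {v : α → Fin 2 → ℝ} {P : Finset α}
    (h : GenPos v P) (r : ℝ) (hinj : Set.InjOn (fun i => v i 0 + r * v i 1) P)
    (a b c : α) (ha : a ∈ P) (hb : b ∈ P) (hc : c ∈ P) (hab : a ≠ b) (hac : a ≠ c) (hbc : b ≠ c) :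
    orient (fun i => v i 0 + r * v i 1) (fun i => v i 1) a b c ≠ 0 := by
  classical
  set x := fun i => v i 0 + r * v i 1 with hx
  intro ho
  have h3 : ∀ f : α → Fin 2 → ℝ, ∑ i ∈ ({a, b, c} : Finset α), f i = f a + f b + f c := by
    intro f
    rw [sum_insert (by simp [hab, hac]), sum_pair hbc, add_assoc]
  have h3' : ∀ f : α → ℝ, ∑ i ∈ ({a, b, c} : Finset α), f i = f a + f b + f c := by
    intro f
    rw [sum_insert (by simp [hab, hac]), sum_pair hbc, add_assoc]
  have := h {a, b, c} (by simp [insert_subset_iff, ha, hb, hc])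
    (card_le_three) (fun i => if i = a then x c - x b else if i = b then x a - x c else
      x b - x a)
    (by rw [h3']; simp only [if_true, if_neg hab.symm, if_neg hac.symm, if_neg hbc.symm]; ring)
    (by
      rw [h3]; simp only [if_true, if_neg hab.symm, if_neg hac.symm, if_neg hbc.symm]
      have e1 : (x c - x b) * v a 1 + (x a - x c) * v b 1 + (x b - x a) * v c 1 = 0 := by
        rw [← ho]; simp only [orient]; ring
      have e0 : (x c - x b) * x a + (x a - x c) * x b + (x b - x a) * x c = 0 := by ring
      ext l
      fin_cases l
      · simp only [Fin.zero_eta, Fin.isValue, Pi.add_apply, Pi.smul_apply, smul_eq_mul,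
          Pi.zero_apply]
        have e2 : ∀ i, x i = v i 0 + r * v i 1 := fun i => rfl
        rw [e2 a, e2 b, e2 c] at e0 ⊢
        rw [e2 a, e2 b, e2 c] at e1
        linear_combination e0 - r * e1
      · simpa using e1) c (by simp)
  simp only [if_neg hac.symm, if_neg hbc.symm] at this
  exact hab (hinj ha hb (by linarith))

/-- Every `n ≥ 3` points in general position in the plane span a crossing family of size
`√n / 15`. -/
theorem exists_planar_family {α : Type} (v : α → Fin 2 → ℝ) (P : Finset α) (h : GenPos v P)
    (hP : 2 < P.card) :
    ∃ F, IsFamily v P F ∧ (1 / 15 : ℝ) * Real.sqrt P.card ≤ F.card := by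
  obtain ⟨r, hr⟩ := exists_shear v P (h.injOn (by norm_num))
  set n := P.card with hn
  obtain ⟨m, hm1, hm2⟩ : ∃ m, 6 * m + 3 ≤ n ∧ n < 6 * m + 9 := ⟨(n - 3) / 6, by omega, by omega⟩
  set q := Nat.sqrt (m + 1) with hq
  have hq1 : q * q ≤ m + 1 := Nat.sqrt_le _
  have hq2 : m + 1 < (q + 1) * (q + 1) := Nat.lt_succ_sqrt _
  have hF : ∀ k, (2 * k + 1) * (2 * k + 1) ≤ m + 1 → ∃ F, IsFamily v P F ∧ F.card = k := by
    intro k hk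
    rcases exists_orientedPairs (fun i => v i 0 + r * v i 1) (fun i => v i 1) P hr
      (fun a ha b hb c hc => h.orient_ne_zero r hr a b c ha hb hc) k m hk (hn ▸ hm1) with h1 | h1
    · exact exists_family_of_orientedPairs v _ _ 1 one_ne_zero (fun i => by ring) r
        (fun i => rfl) P k h1
    · exact exists_family_of_orientedPairs v _ _ (-1) (by norm_num) (fun i => by ring) r
        (fun i => rfl) P k h1
  have hF1 : ∃ F, IsFamily v P F ∧ F.card = 1 := by
    obtain ⟨s, hs, hc⟩ := exists_subset_card_eq (show 2 ≤ P.card by omega)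
    exact ⟨{s}, IsFamily.singleton v hs hc, card_singleton _⟩
  -- For `q < 3` a single segment does, with `k = 1`. In either case `q + 1 ≤ 2 * k + 3 ≤ 5 * k`,
  -- whence `n ≤ (15 * k) ^ 2`.
  obtain ⟨k, hk, F, hF2, hF3⟩ : ∃ k, q ≤ 2 * k + 2 ∧ ∃ F, IsFamily v P F ∧ F.card = k ∧ 1 ≤ k := by
    by_cases hq3 : 3 ≤ q
    · obtain ⟨F, h1, h2⟩ := hF ((q - 1) / 2) (le_trans (Nat.mul_self_le_mul_self (by omega)) hq1)
      exact ⟨(q - 1) / 2, by omega, F, h1, h2, by omega⟩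
    · obtain ⟨F, h1, h2⟩ := hF1
      exact ⟨1, by omega, F, h1, h2, le_rfl⟩
  refine ⟨F, hF2, ?_⟩
  have hle : (q + 1) * (q + 1) ≤ (5 * k) * (5 * k) := Nat.mul_self_le_mul_self (by omega)
  have hn' : n ≤ (15 * k) * (15 * k) := by nlinarith
  have : Real.sqrt n ≤ 15 * k := by
    rw [Real.sqrt_le_left (by positivity)]
    have : (n : ℝ) ≤ ((15 * k) * (15 * k) : ℕ) := by exact_mod_cast hn'
    push_cast at this
    nlinarith
  rw [hF3.1]
  linarith

/-! ### Open cones and theorems of the alternative -/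

/-- A surjective linear map is open, and the open positive orthant is mapped to this set. -/
lemma isOpen_positive_combinations {ι F : Type} [Fintype ι] [NormedAddCommGroup F]
    [NormedSpace ℝ F] [FiniteDimensional ℝ F] (a : ι → F)
    (ha : Submodule.span ℝ (Set.range a) = ⊤) :
    IsOpen {z : F | ∃ w : ι → ℝ, (∀ i, 0 < w i) ∧ ∑ i, w i • a i = z} := by
  have hsurj : Function.Surjective (Fintype.linearCombination ℝ a) := by
    rw [← LinearMap.range_eq_top, Fintype.range_linearCombination, ha]
  have hopen := LinearMap.isOpenMap_of_finiteDimensional (Fintype.linearCombination ℝ a) hsurj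
  have : IsOpen {w : ι → ℝ | ∀ i, 0 < w i} := by
    simp only [Set.ofPred_forall]
    exact isOpen_iInter_of_finite fun i => isOpen_lt continuous_const (continuous_apply i)
  convert hopen _ this using 1
  ext z
  simp [Fintype.linearCombination_apply]

lemma isOpen_positive_combinations_finset {α F : Type} [NormedAddCommGroup F]
    [NormedSpace ℝ F] [FiniteDimensional ℝ F] (a : α → F) (T : Finset α)
    (ha : Submodule.span ℝ (a '' T) = ⊤) :
    IsOpen {z : F | ∃ w : α → ℝ, (∀ i ∈ T, 0 < w i) ∧ ∑ i ∈ T, w i • a i = z} := by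
  classical
  have h := isOpen_positive_combinations (fun i : T => a i) (by
    rw [← ha]; congr 1; ext z; simp)
  convert h using 3 with z
  constructor
  · rintro ⟨w, hw, hz⟩
    exact ⟨fun i => w i, fun i => hw i i.2, by rw [← hz, ← sum_coe_sort T]⟩
  · rintro ⟨w, hw, hz⟩
    refine ⟨fun i => if h : i ∈ T then w ⟨i, h⟩ else 0, fun i hi => by simp [hi, hw], ?_⟩
    rw [← hz, ← sum_coe_sort T]
    exact sum_congr rfl fun i _ => by simp

/-- A nonnegative combination whose support spans can be rewritten with positive coefficients. -/
lemma exists_positive_combination {α F : Type} [NormedAddCommGroup F]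
    [NormedSpace ℝ F] [FiniteDimensional ℝ F] (a : α → F) (T : Finset α) (w : α → ℝ)
    (hw : ∀ i ∈ T, 0 ≤ w i) (ha : Submodule.span ℝ (a '' {i | i ∈ T ∧ 0 < w i}) = ⊤) :
    ∃ w' : α → ℝ, (∀ i ∈ T, 0 < w' i) ∧ ∑ i ∈ T, w' i • a i = ∑ i ∈ T, w i • a i := by
  classical
  set T' := T.filter fun i => 0 < w i with hT'
  have ha' : Submodule.span ℝ (a '' (T' : Set α)) = ⊤ := by
    rw [← ha]; congr 2; ext i; simp [hT']
  have hopen := isOpen_positive_combinations_finset a T' ha'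
  set U := {z : F | ∃ w : α → ℝ, (∀ i ∈ T', 0 < w i) ∧ ∑ i ∈ T', w i • a i = z} with hU
  have hsum : ∑ i ∈ T, w i • a i = ∑ i ∈ T', w i • a i := by
    symm
    apply sum_subset (filter_subset _ _)
    intro i hi hn
    have : w i = 0 := le_antisymm (not_lt.1 fun h => hn (mem_filter.2 ⟨hi, h⟩)) (hw i hi)
    simp [this]
  have hmem : ∑ i ∈ T, w i • a i ∈ U := ⟨w, fun i hi => (mem_filter.1 hi).2, hsum.symm⟩
  -- Subtracting a small multiple `ε` of the vectors outside `T'` stays in the open cone of `T'`;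
  -- adding it back gives those vectors the weight `ε`.
  have hcont : Continuous fun ε : ℝ => ∑ i ∈ T, w i • a i - ε • ∑ i ∈ T \ T', a i := by fun_prop
  have hev : ∀ᶠ ε : ℝ in nhds 0, ∑ i ∈ T, w i • a i - ε • ∑ i ∈ T \ T', a i ∈ U :=
    hcont.continuousAt.preimage_mem_nhds (hopen.mem_nhds (by simpa using hmem))
  obtain ⟨ε, ⟨w1, hw1, hs1⟩, hε⟩ :=
    ((hev.filter_mono nhdsWithin_le_nhds).and (self_mem_nhdsWithin (s := Set.Ioi (0:ℝ)))).exists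
  refine ⟨fun i => if i ∈ T' then w1 i else ε, fun i hi => ?_, ?_⟩
  · dsimp only
    split_ifs with h
    · exact hw1 i h
    · exact hε
  · rw [← sum_sdiff (filter_subset (fun i => 0 < w i) T)]
    rw [sum_congr rfl (g := fun i => ε • a i) (s₁ := T \ T')
        (fun i hi => by dsimp only; rw [if_neg (mem_sdiff.1 hi).2]), ← smul_sum,
      sum_congr rfl (g := fun i => w1 i • a i) (s₁ := T') (fun i hi => by dsimp only; rw [if_pos hi]), hs1]
    abel

/-- Gordan's alternative. -/
lemma exists_positive_functional {α F : Type} [NormedAddCommGroup F]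
    [NormedSpace ℝ F] [FiniteDimensional ℝ F] (a : α → F) (T : Finset α)
    (h : ∀ w : α → ℝ, (∀ i ∈ T, 0 ≤ w i) → ∑ i ∈ T, w i • a i = 0 → ∀ i ∈ T, w i = 0) :
    ∃ g : F →L[ℝ] ℝ, ∀ i ∈ T, 0 < g (a i) := by
  classical
  set L := Fintype.linearCombination ℝ (fun i : T => a i) with hL
  set K := L '' stdSimplex ℝ T with hK
  have hLc : Continuous L := LinearMap.continuous_of_finiteDimensional L
  have hKc : IsCompact K := (isCompact_stdSimplex ℝ T).image hLc
  have hKconv : Convex ℝ K := (convex_stdSimplex ℝ T).linear_image L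
  -- `K` is the convex hull of the vectors. If it contained `0`, there would be a nonnegative
  -- relation with total weight `1`.
  have h0 : Disjoint ({0} : Set F) K := by
    rw [Set.disjoint_singleton_left]
    rintro ⟨w, hw, hz⟩
    have := h (fun i => if h : i ∈ T then w ⟨i, h⟩ else 0) (fun i hi => by simp [hi, hw.1]) (by
      rw [← hz, hL, Fintype.linearCombination_apply, ← sum_coe_sort T]
      exact sum_congr rfl fun i _ => by simp)
    have h1 := hw.2
    rw [sum_eq_zero] at h1
    · exact zero_ne_one h1
    · intro i _
      simpa using this i i.2
  obtain ⟨f, u, v, h1, h2, h3⟩ := geometric_hahn_banach_compact_closed (convex_singleton (0:F))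
    isCompact_singleton hKconv hKc.isClosed h0
  refine ⟨f, fun i hi => ?_⟩
  have h4 := h1 0 rfl
  rw [map_zero] at h4
  have : a i ∈ K := ⟨Pi.single ⟨i, hi⟩ 1, single_mem_stdSimplex _ _, by
    rw [hL, Fintype.linearCombination_apply_single, one_smul]⟩
  linarith [h3 _ this]

/-- Seen from `x`, the cones over `s` and `t` cross. -/
def ViewCrosses {α : Type} {d : ℕ} (v : α → Fin d → ℝ) (s t : Finset α) (x : Fin d → ℝ) : Prop :=
  ∃ w : α → ℝ, (∀ i ∈ s, 0 < w i) ∧ (∀ i ∈ t, 0 < w i) ∧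
    ∑ i ∈ s, w i • (v i - x) = ∑ i ∈ t, w i • (v i - x)

lemma span_eq_top_of_card {α F : Type} [AddCommGroup F] [Module ℝ F]
    [FiniteDimensional ℝ F] (a : α → F) (T : Finset α) (hc : T.card = Module.finrank ℝ F)
    (h : ∀ w : α → ℝ, ∑ i ∈ T, w i • a i = 0 → ∀ i ∈ T, w i = 0) :
    Submodule.span ℝ (a '' T) = ⊤ := by
  classical
  have hli : LinearIndependent ℝ (fun i : T => a i) := by
    rw [Fintype.linearIndependent_iff]
    intro g hg i
    have := h (fun i => if h : i ∈ T then g ⟨i, h⟩ else 0) (by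
      rw [← hg, ← sum_coe_sort T]
      exact sum_congr rfl fun i _ => by simp) i i.2
    simpa using this
  have := hli.span_eq_top_of_card_eq_finrank' (by simpa using hc)
  rw [← this]; congr 1; ext z; simp

/-- The sign with which the vectors of `s` and of its complement enter a crossing relation. -/
def sgnOf {α : Type} [DecidableEq α] (s : Finset α) (i : α) : ℝ := if i ∈ s then 1 else -1

lemma sgnOf_ne_zero {α : Type} [DecidableEq α] (s : Finset α) (i : α) : sgnOf s i ≠ 0 := by
  unfold sgnOf; split_ifs <;> norm_num

lemma sum_union_sgnOf {α F : Type} [DecidableEq α] [AddCommGroup F] [Module ℝ F]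
    {s t : Finset α} (hst : Disjoint s t) (w : α → ℝ) (a : α → F) :
    ∑ i ∈ s ∪ t, w i • (sgnOf s i • a i) = ∑ i ∈ s, w i • a i - ∑ i ∈ t, w i • a i := by
  rw [sum_union hst, sub_eq_add_neg, ← sum_neg_distrib]
  congr 1
  · exact sum_congr rfl fun i hi => by simp [sgnOf, hi]
  · refine sum_congr rfl fun i hi => ?_
    simp [sgnOf, disjoint_right.1 hst hi]

lemma span_sgnOf {α F : Type} [DecidableEq α] [AddCommGroup F] [Module ℝ F]
    (s : Finset α) (a : α → F) (T : Set α) (h : Submodule.span ℝ (a '' T) = ⊤) :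
    Submodule.span ℝ ((fun i => sgnOf s i • a i) '' T) = ⊤ := by
  rw [eq_top_iff, ← h, Submodule.span_le]
  rintro _ ⟨i, hi, rfl⟩
  have := Submodule.smul_mem (Submodule.span ℝ ((fun i => sgnOf s i • a i) '' T)) (sgnOf s i)⁻¹
    (Submodule.subset_span ⟨i, hi, rfl⟩)
  rwa [smul_smul, inv_mul_cancel₀ (sgnOf_ne_zero s i), one_smul] at this

/-- Any nontrivial nonnegative relation between the cones over `s` and `t` can be made positive. -/
lemma positive_or_separated {α F : Type} [DecidableEq α] [NormedAddCommGroup F]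
    [NormedSpace ℝ F] [FiniteDimensional ℝ F] (a : α → F) (s t : Finset α) (hst : Disjoint s t)
    (h : ∀ D ⊆ s ∪ t, D.card ≤ Module.finrank ℝ F → ∀ w : α → ℝ, ∑ i ∈ D, w i • a i = 0 →
      ∀ i ∈ D, w i = 0) :
    (∃ w : α → ℝ, (∀ i ∈ s, 0 < w i) ∧ (∀ i ∈ t, 0 < w i) ∧
      ∑ i ∈ s, w i • a i = ∑ i ∈ t, w i • a i) ∨
    ∃ g : F →L[ℝ] ℝ, (∀ i ∈ s, 0 < g (a i)) ∧ ∀ i ∈ t, g (a i) < 0 := by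
  by_cases hcase : ∀ w : α → ℝ, (∀ i ∈ s ∪ t, 0 ≤ w i) →
      ∑ i ∈ s ∪ t, w i • (sgnOf s i • a i) = 0 → ∀ i ∈ s ∪ t, w i = 0
  · right
    obtain ⟨g, hg⟩ := exists_positive_functional _ _ hcase
    refine ⟨g, fun i hi => ?_, fun i hi => ?_⟩
    · simpa [sgnOf, hi] using hg i (mem_union_left _ hi)
    · simpa [sgnOf, disjoint_right.1 hst hi] using hg i (mem_union_right _ hi)
  · left
    push Not at hcase
    obtain ⟨w, hw, hsum, i0, hi0, hne⟩ := hcase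
    set T := (s ∪ t).filter fun i => 0 < w i with hT
    have hTs : T ⊆ s ∪ t := filter_subset _ _
    have hsumT : ∑ i ∈ T, (w i * sgnOf s i) • a i = 0 := by
      rw [← hsum]
      simp only [smul_smul]
      apply sum_subset hTs
      intro i hi hn
      have : w i = 0 := le_antisymm (not_lt.1 fun h => hn (mem_filter.2 ⟨hi, h⟩)) (hw i hi)
      simp [this]
    have hi0T : i0 ∈ T := mem_filter.2 ⟨hi0, lt_of_le_of_ne (hw i0 hi0) (Ne.symm hne)⟩
    -- By independence a nontrivial relation has more than `finrank` vectors in its support. The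
    -- support therefore spans, which lets all remaining weights become positive.
    have hcard : Module.finrank ℝ F < T.card := by
      by_contra hcon
      push Not at hcon
      exact mul_ne_zero hne (sgnOf_ne_zero s i0) (h T hTs hcon _ hsumT i0 hi0T)
    obtain ⟨D, hD, hDc⟩ := exists_subset_card_eq hcard.le
    have hspan : Submodule.span ℝ (a '' {i | i ∈ s ∪ t ∧ 0 < w i}) = ⊤ := by
      rw [eq_top_iff, ← span_eq_top_of_card a D hDc (h D (hD.trans hTs) hDc.le)]
      exact Submodule.span_mono (Set.image_mono fun i hi => mem_filter.1 (hD hi))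
    obtain ⟨w', hw', hs'⟩ := exists_positive_combination (fun i => sgnOf s i • a i) (s ∪ t) w hw
      (span_sgnOf s a _ hspan)
    rw [hsum, sum_union_sgnOf hst, sub_eq_zero] at hs'
    exact ⟨w', fun i hi => hw' i (mem_union_left _ hi), fun i hi => hw' i (mem_union_right _ hi),
      hs'⟩

/-! ### Crossing as seen from a moving viewpoint -/

/-- Homogenization turns affine dependences into linear ones, to which the alternatives above apply.
-/
lemma GenPos.lift {α : Type} {d : ℕ} {v : α → Fin d → ℝ} {P : Finset α} (h : GenPos v P)
    (D : Finset α) (hD : D ⊆ P) (hc : D.card ≤ d + 1) (w : α → ℝ)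
    (hw : ∑ i ∈ D, w i • ((v i, (1 : ℝ)) : (Fin d → ℝ) × ℝ) = 0) : ∀ i ∈ D, w i = 0 := by
  rw [Prod.ext_iff, Prod.fst_sum, Prod.snd_sum] at hw
  refine h D hD hc w ?_ ?_
  · simpa using hw.2
  · simpa using hw.1

lemma not_viewCrosses_of_separated {α : Type} {d : ℕ} {v : α → Fin d → ℝ} {s t : Finset α}
    (hs : s.Nonempty) (x : Fin d → ℝ) (g : (Fin d → ℝ) →ₗ[ℝ] ℝ)
    (h1 : ∀ i ∈ s, 0 < g (v i - x)) (h2 : ∀ i ∈ t, g (v i - x) < 0) : ¬ ViewCrosses v s t x := by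
  rintro ⟨w, hw1, hw2, he⟩
  have := congrArg g he
  simp only [map_sum, map_smul, smul_eq_mul] at this
  have h3 : 0 < ∑ i ∈ s, w i * g (v i - x) := sum_pos (fun i hi => mul_pos (hw1 i hi) (h1 i hi)) hs
  have h4 : ∑ i ∈ t, w i * g (v i - x) ≤ 0 :=
    sum_nonpos fun i hi => (mul_neg_of_pos_of_neg (hw2 i hi) (h2 i hi)).le
  linarith

/-- Crossing as seen from `x` means that some multiple `c • (x, 1)` is a positive combination of the
lifts of `s` minus one of the lifts of `t`; `c` is the difference of the total weights. Such
differences form an open cone because `d + 1` of the lifted points are a basis. -/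
lemma isOpen_viewCrosses {α : Type} [DecidableEq α] {d : ℕ} (v : α → Fin d → ℝ) {P : Finset α}
    (h : GenPos v P)
    (s t : Finset α) (hst : Disjoint s t) (hs : s ⊆ P) (ht : t ⊆ P) (hc : d + 1 ≤ (s ∪ t).card) :
    IsOpen {x | ViewCrosses v s t x} := by
  set u : α → (Fin d → ℝ) × ℝ := fun i => (v i, 1) with hu
  obtain ⟨D, hD, hDc⟩ := exists_subset_card_eq hc
  have hspan : Submodule.span ℝ (u '' (s ∪ t : Finset α)) = ⊤ := by
    rw [eq_top_iff, ← span_eq_top_of_card u D (by simp [hDc])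
      (h.lift D (hD.trans (union_subset hs ht)) hDc.le)]
    exact Submodule.span_mono (Set.image_mono hD)
  have hopen := isOpen_positive_combinations_finset (fun i => sgnOf s i • u i) (s ∪ t)
    (span_sgnOf s u _ hspan)
  set U := {z : (Fin d → ℝ) × ℝ | ∃ w : α → ℝ, (∀ i ∈ s ∪ t, 0 < w i) ∧
    ∑ i ∈ s ∪ t, w i • sgnOf s i • u i = z} with hU
  have : {x | ViewCrosses v s t x} =
      ⋃ c : ℝ, (fun x : Fin d → ℝ => ((c • x, c) : (Fin d → ℝ) × ℝ)) ⁻¹' U := by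
    ext x
    simp only [Set.mem_ofPred_eq, Set.mem_iUnion, Set.mem_preimage, ViewCrosses, hU,
      sum_union_sgnOf hst]
    constructor
    · rintro ⟨w, h1, h2, h3⟩
      refine ⟨∑ i ∈ s, w i - ∑ i ∈ t, w i, w, fun i hi => (mem_union.1 hi).elim (h1 i) (h2 i), ?_⟩
      simp only [smul_sub, sum_sub_distrib, ← sum_smul] at h3
      ext1
      · simp only [hu, Prod.fst_sub, Prod.fst_sum, Prod.smul_fst, sub_smul]
        rw [sub_eq_sub_iff_sub_eq_sub, h3]
      · simp [hu, Prod.snd_sum]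
    · rintro ⟨c, w, h1, h2⟩
      refine ⟨w, fun i hi => h1 i (mem_union_left _ hi), fun i hi => h1 i (mem_union_right _ hi),
        ?_⟩
      have h3 := congrArg Prod.fst h2
      have h4 := congrArg Prod.snd h2
      simp only [hu, Prod.fst_sub, Prod.fst_sum, Prod.smul_fst] at h3
      simp only [hu, Prod.snd_sub, Prod.snd_sum, Prod.smul_snd, smul_eq_mul, mul_one] at h4
      simp only [smul_sub, sum_sub_distrib, ← sum_smul]
      rw [sub_eq_sub_iff_sub_eq_sub, h3, ← sub_smul, h4]
  rw [this]
  exact isOpen_iUnion fun c => hopen.preimage (by fun_prop)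

/-- Crossing as seen from `b` persists along a segment that misses all hyperplanes spanned by
`s ∪ t`. -/
lemma ViewCrosses.segment {α : Type} [DecidableEq α] {d : ℕ} {v : α → Fin d → ℝ} {P : Finset α}
    (h : GenPos v P) {s t : Finset α} (hst : Disjoint s t) (hs : s ⊆ P) (ht : t ⊆ P)
    (hne : s.Nonempty) (hc : d + 1 ≤ (s ∪ t).card) (b b' : Fin d → ℝ)
    (hind : ∀ τ ∈ Set.Icc (0 : ℝ) 1, ∀ D ⊆ s ∪ t, D.card ≤ d → ∀ w : α → ℝ,
      ∑ i ∈ D, w i • (v i - (b + τ • (b' - b))) = 0 → ∀ i ∈ D, w i = 0)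
    (hb : ViewCrosses v s t b) (τ : ℝ) (hτ : τ ∈ Set.Icc (0 : ℝ) 1) :
    ViewCrosses v s t (b + τ • (b' - b)) := by
  set U := {τ : ℝ | ViewCrosses v s t (b + τ • (b' - b))} with hU
  set N := {τ : ℝ | ∃ g : (Fin d → ℝ) →L[ℝ] ℝ, (∀ i ∈ s, 0 < g (v i - (b + τ • (b' - b)))) ∧
    ∀ i ∈ t, g (v i - (b + τ • (b' - b))) < 0} with hN
  have hUo : IsOpen U := (isOpen_viewCrosses v h s t hst hs ht hc).preimage
    (f := fun τ : ℝ => b + τ • (b' - b)) (by fun_prop)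
  have hNo : IsOpen N := by
    rw [hN, Set.ofPred_exists]
    refine isOpen_iUnion fun g => ?_
    rw [Set.ofPred_and]
    refine IsOpen.inter ?_ ?_
    · rw [show {τ : ℝ | ∀ i ∈ s, 0 < g (v i - (b + τ • (b' - b)))} =
        ⋂ i ∈ s, {τ : ℝ | 0 < g (v i - (b + τ • (b' - b)))} by ext; simp]
      exact isOpen_biInter_finset fun i _ => isOpen_lt continuous_const (by fun_prop)
    · rw [show {τ : ℝ | ∀ i ∈ t, g (v i - (b + τ • (b' - b))) < 0} =
        ⋂ i ∈ t, {τ : ℝ | g (v i - (b + τ • (b' - b))) < 0} by ext; simp]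
      exact isOpen_biInter_finset fun i _ => isOpen_lt (by fun_prop) continuous_const
  have hdisj : Disjoint U N := by
    rw [Set.disjoint_left]
    rintro τ hτ ⟨g, h1, h2⟩
    exact not_viewCrosses_of_separated hne _ g.toLinearMap h1 h2 hτ
  -- Being crossing and being strictly separated are disjoint open conditions on `τ`. Without
  -- degeneracies they exhaust `[0, 1]`, so connectedness leaves only the first.
  have hcov : Set.Icc (0 : ℝ) 1 ⊆ U ∪ N := by
    intro τ hτ
    exact positive_or_separated _ s t hst (fun D hD hDc => hind τ hτ D hD (by simpa using hDc))
  exact isPreconnected_Icc.subset_left_of_subset_union hUo hNo hdisj hcov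
    ⟨0, by simp, by simpa [hU] using hb⟩ hτ

/-- Along the segment from `b` to `b'`, any at most `d` points of `A` stay independent as seen from
the moving viewpoint. -/
lemma independent_along_segment {α : Type} {d : ℕ} {v : α → Fin d → ℝ}
    {P A : Finset α} (h : GenPos v P) (hA : A ⊆ P) {b b' : α}
    (hsep : ∀ D ⊆ A, D.card = d → ∃ (g : (Fin d → ℝ) →ₗ[ℝ] ℝ) (γ : ℝ),
      (∀ i ∈ D, g (v i) = γ) ∧ γ < g (v b) ∧ γ < g (v b'))
    (hAc : d ≤ A.card) : ∀ τ ∈ Set.Icc (0 : ℝ) 1, ∀ D ⊆ A, D.card ≤ d → ∀ w : α → ℝ,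
      ∑ i ∈ D, w i • (v i - (v b + τ • (v b' - v b))) = 0 → ∀ i ∈ D, w i = 0 := by
  intro τ hτ D hDA hDc w hw
  obtain ⟨D', hD', hD'A, hD'c⟩ := exists_subsuperset_card_eq hDA hDc hAc
  obtain ⟨g, γ, h1, h2, h3⟩ := hsep D' hD'A hD'c
  set x := v b + τ • (v b' - v b) with hx
  have hgx : γ < g x := by
    rw [hx, map_add, map_smul, map_sub, smul_eq_mul]
    rcases eq_or_lt_of_le hτ.1 with h0 | h0
    · rw [← h0]; linarith
    · nlinarith [mul_nonneg (sub_nonneg.2 hτ.2) (sub_pos.2 h2).le, mul_pos h0 (sub_pos.2 h3)]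
  -- On `D` the functional `g` is the constant `γ`, and the viewpoint lies strictly off that
  -- hyperplane. Hence the total weight vanishes and the relation becomes an affine dependence in
  -- `P`.
  have h4 := congrArg g hw
  rw [map_sum, map_zero, sum_congr rfl (g := fun i => w i * (γ - g x)) (fun i hi => by
    rw [map_smul, map_sub, h1 i (hD' hi), smul_eq_mul]), ← sum_mul] at h4
  have h5 : ∑ i ∈ D, w i = 0 := (mul_eq_zero.1 h4).resolve_right (by linarith)
  refine h D (hDA.trans hA) (by omega) w h5 ?_
  simpa only [smul_sub, sum_sub_distrib, ← sum_smul, h5, zero_smul, sub_zero] using hw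

/-- Here `3 ≤ d` is essential: two disjoint sets of `d - 1` points have `2 * d - 2 ≥ d + 1` points
together, as the openness of the crossing condition requires. -/
lemma viewCrosses_of_avoiding {α : Type} [DecidableEq α] {d : ℕ} (hd : 3 ≤ d) {v : α → Fin d → ℝ}
    {P A : Finset α} (h : GenPos v P) (hA : A ⊆ P) {b b' : α}
    (hsep : ∀ D ⊆ A, D.card = d → ∃ (g : (Fin d → ℝ) →ₗ[ℝ] ℝ) (γ : ℝ),
      (∀ i ∈ D, g (v i) = γ) ∧ γ < g (v b) ∧ γ < g (v b'))
    {s t : Finset α} (hs : s ⊆ A) (ht : t ⊆ A) (hst : Disjoint s t) (hsc : s.card + 1 = d)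
    (htc : t.card + 1 = d) (hview : ViewCrosses v s t (v b)) (τ : ℝ) (hτ : τ ∈ Set.Icc (0 : ℝ) 1) :
    ViewCrosses v s t (v b + τ • (v b' - v b)) := by
  have hcard : (s ∪ t).card = s.card + t.card := card_union_of_disjoint hst
  have hsub := union_subset hs ht
  have hAc := card_le_card hsub
  have hind := independent_along_segment h hA hsep (by omega)
  exact ViewCrosses.segment h hst (hs.trans hA) (ht.trans hA) (card_pos.1 (by omega)) (by omega)
    (v b) (v b') (fun τ hτ D hD => hind τ hτ D (hD.trans hsub)) hview τ hτ

/-- If the two cones did not cross, an affine functional would be positive on `b` and `s` and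
negative on `b'` and `t`. It vanishes at a point of the segment from `b` to `b'`, and seen from
there `s` and `t` are separated, although their crossing persists along the segment. -/
lemma crosses_insert {α : Type} [DecidableEq α] {d : ℕ} (hd : 3 ≤ d) {v : α → Fin d → ℝ}
    {P A : Finset α} (h : GenPos v P) (hA : A ⊆ P) {b b' : α} (hb : b ∈ P) (hb' : b' ∈ P)
    (hbb : b ≠ b') (hbA : b ∉ A) (hbA' : b' ∉ A)
    (hsep : ∀ D ⊆ A, D.card = d → ∃ (g : (Fin d → ℝ) →ₗ[ℝ] ℝ) (γ : ℝ),
      (∀ i ∈ D, g (v i) = γ) ∧ γ < g (v b) ∧ γ < g (v b'))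
    {s t : Finset α} (hs : s ⊆ A) (ht : t ⊆ A) (hst : Disjoint s t) (hsc : s.card + 1 = d)
    (htc : t.card + 1 = d) (hview : ViewCrosses v s t (v b)) :
    Crosses v (insert b s) (insert b' t) := by
  have hne : s.Nonempty := card_pos.1 (by omega)
  have hdisj : Disjoint (insert b s) (insert b' t) := by
    rw [disjoint_insert_left, disjoint_insert_right, mem_insert, not_or]
    exact ⟨⟨hbb, fun hh => hbA (ht hh)⟩, fun hh => hbA' (hs hh), hst⟩
  refine ⟨hdisj, ?_⟩
  have hsub : insert b s ∪ insert b' t ⊆ P := union_subset (insert_subset hb (hs.trans hA))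
    (insert_subset hb' (ht.trans hA))
  rcases positive_or_separated (fun i => ((v i, (1 : ℝ)) : (Fin d → ℝ) × ℝ)) _ _ hdisj
    (fun D hD hDc => h.lift D (hD.trans hsub) (by simpa using hDc)) with ⟨w, h1, h2, h3⟩ | ⟨g, h1, h2⟩
  · refine ⟨w, h1, h2, ?_, ?_⟩
    · simpa [Prod.snd_sum] using congrArg Prod.snd h3
    · simpa [Prod.fst_sum] using congrArg Prod.fst h3
  · exfalso
    have hp := h1 b (mem_insert_self _ _)
    have hn := h2 b' (mem_insert_self _ _)
    set p := g (v b, 1) with hp'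
    set n := g (v b', 1) with hn'
    have hpn : 0 < p - n := by linarith
    set τ := p / (p - n) with hτ
    have hτ1 : τ ∈ Set.Icc (0 : ℝ) 1 := ⟨by positivity, by rw [div_le_one hpn]; linarith⟩
    have hx : g (v b + τ • (v b' - v b), 1) = 0 := by
      have : ((v b + τ • (v b' - v b), 1) : (Fin d → ℝ) × ℝ) =
          (v b, 1) + τ • ((v b', 1) - (v b, 1)) := by ext <;> simp
      rw [this, map_add, map_smul, map_sub, ← hp', ← hn', smul_eq_mul, hτ]
      field_simp
      ring
    have hg : ∀ i, g (v i, 1) = g (v i - (v b + τ • (v b' - v b)), 0) := by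
      intro i
      have : ((v i, 1) : (Fin d → ℝ) × ℝ) = (v i - (v b + τ • (v b' - v b)), 0) +
          (v b + τ • (v b' - v b), 1) := by ext <;> simp
      rw [this, map_add, hx, add_zero]
    refine not_viewCrosses_of_separated hne (v b + τ • (v b' - v b))
      (g.toLinearMap.comp (LinearMap.inl ℝ _ ℝ)) (fun i hi => ?_) (fun i hi => ?_)
      (viewCrosses_of_avoiding hd h hA hsep hs ht hst hsc htc hview τ hτ1)
    · simpa [← hg] using h1 i (mem_insert_of_mem hi)
    · simpa [← hg] using h2 i (mem_insert_of_mem hi)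

/-! ### Central projection -/

/-- Project onto the kernel of `f` along a complement and identify the kernel with `ℝ^d`. The pair
`(f, q)` then determines a vector, which makes perspective coordinates faithful. -/
lemma exists_complementary_projection {d : ℕ} (f : (Fin (d + 1) → ℝ) →ₗ[ℝ] ℝ) (hf : f ≠ 0) :
    ∃ q : (Fin (d + 1) → ℝ) →ₗ[ℝ] (Fin d → ℝ), ∀ x, f x = 0 → q x = 0 → x = 0 := by
  have hr : Module.finrank ℝ (LinearMap.ker f) = d := by
    have h1 := Module.Dual.finrank_ker_add_one_of_ne_zero hf
    simpa using h1
  obtain ⟨K, hK⟩ := (LinearMap.ker f).exists_isCompl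
  let e : LinearMap.ker f ≃ₗ[ℝ] (Fin d → ℝ) := LinearEquiv.ofFinrankEq _ _ (by simp [hr])
  refine ⟨e.toLinearMap.comp ((LinearMap.ker f).projectionOnto K hK), fun x hx hq => ?_⟩
  have h1 : (LinearMap.ker f).projectionOnto K hK x = 0 := by simpa using hq
  have h2 := Submodule.projectionOnto_apply_left hK ⟨x, hx⟩
  have h3 := congrArg Subtype.val (h2.symm.trans h1)
  simpa using h3

/-- Central projection from a point on the other side of a hyperplane. -/
lemma exists_central_projection {α : Type} {d : ℕ} {v : α → Fin (d + 1) → ℝ}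
    {P A : Finset α} (h : GenPos v P) (hA : A ⊆ P) {b : α} (hb : b ∈ P)
    (f : (Fin (d + 1) → ℝ) →ₗ[ℝ] ℝ) (hf : ∀ a ∈ A, f (v b) < f (v a)) :
    ∃ v' : α → Fin d → ℝ, GenPos v' A ∧
      ∀ s ⊆ A, ∀ t ⊆ A, Crosses v' s t → ViewCrosses v s t (v b) := by
  classical
  rcases A.eq_empty_or_nonempty with rfl | ⟨a0, ha0⟩
  · refine ⟨fun _ _ => 0, fun S hS _ w _ _ i hi => by simpa using hS hi, fun s hs t ht _ => ?_⟩
    rw [subset_empty] at hs ht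
    subst hs ht
    exact ⟨fun _ => 1, by simp, by simp, rfl⟩
  have hf0 : f ≠ 0 := by
    rintro rfl
    simpa using hf a0 ha0
  have hbA : b ∉ A := fun hh => lt_irrefl _ (hf b hh)
  obtain ⟨q, hq⟩ := exists_complementary_projection f hf0
  have hpos : ∀ a ∈ A, 0 < f (v a - v b) := fun a ha => by rw [map_sub]; linarith [hf a ha]
  have key : ∀ (D : Finset α), D ⊆ A → ∀ w : α → ℝ,
      f (∑ i ∈ D, (w i / f (v i - v b)) • (v i - v b)) = ∑ i ∈ D, w i := by
    intro D hD w
    rw [map_sum]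
    refine sum_congr rfl fun i hi => ?_
    rw [map_smul, smul_eq_mul, div_mul_cancel₀ _ (hpos i (hD hi)).ne']
  have key2 : ∀ (D : Finset α) (w : α → ℝ),
      q (∑ i ∈ D, (w i / f (v i - v b)) • (v i - v b)) =
        ∑ i ∈ D, w i • ((f (v i - v b))⁻¹ • q (v i - v b)) := by
    intro D w
    rw [map_sum]
    exact sum_congr rfl fun i hi => by rw [map_smul, smul_smul, div_eq_mul_inv]
  -- Each ray from `b` is cut at `f = 1` and flattened by `q`. A weight `w i` on a projected point
  -- corresponds to `w i / f (v i - v b)` on the ray.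
  refine ⟨fun i => (f (v i - v b))⁻¹ • q (v i - v b), ?_, ?_⟩
  · intro S hS hSc w hw0 hw1 i hi
    have hz := hq _ ((key S hS w).trans hw0) ((key2 S w).trans hw1)
    have hbS : b ∉ S := fun hh => hbA (hS hh)
    have hsumw : ∀ g : α → Fin (d + 1) → ℝ, ∑ j ∈ S, (if j = b then
        -∑ i ∈ S, w i / f (v i - v b) else w j / f (v j - v b)) • g j =
        ∑ j ∈ S, (w j / f (v j - v b)) • g j := fun g => sum_congr rfl fun j hj => by
      rw [if_neg (by rintro rfl; exact hbS hj)]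
    have := h (insert b S) (insert_subset hb (hS.trans hA))
      (by rw [card_insert_of_notMem hbS]; omega)
      (fun j => if j = b then -∑ i ∈ S, w i / f (v i - v b) else w j / f (v j - v b))
      (by
        rw [sum_insert hbS, if_pos rfl, sum_congr rfl (fun j hj => if_neg (by
          rintro rfl; exact hbS hj)), neg_add_cancel])
      (by
        rw [sum_insert hbS, if_pos rfl, hsumw, neg_smul, sum_smul, ← sub_eq_neg_add,
          ← sum_sub_distrib, ← hz]
        exact sum_congr rfl fun j _ => (smul_sub _ _ _).symm) i (mem_insert_of_mem hi)
    rw [if_neg (by rintro rfl; exact hbS hi), div_eq_zero_iff] at this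
    exact this.resolve_right (hpos i (hS hi)).ne'
  · rintro s hs t ht ⟨-, w, h1, h2, h3, h4⟩
    refine ⟨fun i => w i / f (v i - v b), fun i hi => div_pos (h1 i hi) (hpos i (hs hi)),
      fun i hi => div_pos (h2 i hi) (hpos i (ht hi)), ?_⟩
    rw [← sub_eq_zero]
    apply hq
    · rw [map_sub, key s hs, key t ht, h3, sub_self]
    · rw [map_sub, key2, key2, h4, sub_self]

/-! ### Simple arrangements and their triangulation -/

/-- The value at `x` of the `i`-th affine functional. -/
def affVal {ι : Type} {d : ℕ} (φ : ι → (Fin d → ℝ) →ₗ[ℝ] ℝ) (c : ι → ℝ) (i : ι)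
    (x : Fin d → ℝ) : ℝ := φ i x - c i

/-- An arrangement of hyperplanes is simple if hyperplanes with a common point have independent
normals. -/
def SimpleArrangement {ι : Type} {d : ℕ} (φ : ι → (Fin d → ℝ) →ₗ[ℝ] ℝ) (c : ι → ℝ) : Prop :=
  ∀ T : Finset ι, (∃ x, ∀ i ∈ T, affVal φ c i x = 0) →
    ∀ w : ι → ℝ, ∑ i ∈ T, w i • φ i = 0 → ∀ i ∈ T, w i = 0

/-- The offsets for which the hyperplanes of `T` have a common point form a subspace `W T`, which is
proper when the normals of `T` are dependent. A line through `c` in a direction outside all proper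
`W T` meets each of them at most once, so arbitrarily small moves along it avoid them all. -/
lemma exists_simple_perturbation {ι : Type} [Fintype ι] {d : ℕ}
    (φ : ι → (Fin d → ℝ) →ₗ[ℝ] ℝ) (c : ι → ℝ) (ε : ℝ) (hε : 0 < ε) :
    ∃ c' : ι → ℝ, (∀ i, |c' i - c i| < ε) ∧ SimpleArrangement φ c' := by
  classical
  let W : Finset ι → Submodule ℝ (ι → ℝ) := fun T =>
    { carrier := {c | ∃ x, ∀ i ∈ T, φ i x = c i}
      add_mem' := by
        rintro a b ⟨x, hx⟩ ⟨y, hy⟩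
        exact ⟨x + y, fun i hi => by rw [map_add, hx i hi, hy i hi]; rfl⟩
      zero_mem' := ⟨0, fun i _ => by simp⟩
      smul_mem' := by
        rintro r a ⟨x, hx⟩
        exact ⟨r • x, fun i hi => by rw [map_smul, hx i hi]; rfl⟩ }
  have hW : ∀ T, W T ≠ ⊤ ∨ ∀ w : ι → ℝ, ∑ i ∈ T, w i • φ i = 0 → ∀ i ∈ T, w i = 0 := by
    intro T
    by_contra! hcon
    obtain ⟨h1, w, hw, i, hi, hne⟩ := hcon
    have : Pi.single i (1 : ℝ) ∈ W T := h1 ▸ Submodule.mem_top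
    obtain ⟨x, hx⟩ := this
    have h2 := LinearMap.congr_fun hw x
    rw [LinearMap.sum_apply] at h2
    simp only [LinearMap.smul_apply, smul_eq_mul, LinearMap.zero_apply] at h2
    rw [sum_eq_single i (fun j hj hji => by rw [hx j hj, Pi.single_eq_of_ne hji, mul_zero])
      (fun h => absurd hi h), hx i hi, Pi.single_eq_same, mul_one] at h2
    exact hne h2
  set 𝒲 : Finset (Submodule ℝ (ι → ℝ)) := (univ.image W).filter (· ≠ ⊤) with h𝒲
  have hun := Subspace.biUnion_ne_univ_of_top_notMem (s := 𝒲) (by simp [h𝒲])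
  obtain ⟨u, hu⟩ := (Set.ne_univ_iff_exists_notMem _).1 hun
  have hbad : ∀ U ∈ 𝒲, {t : ℝ | c + t • u ∈ U}.Finite := by
    intro U hU
    refine Set.Subsingleton.finite fun t ht t' ht' => ?_
    by_contra hne
    have h1 : (c + t • u) - (c + t' • u) ∈ U := U.sub_mem ht ht'
    rw [add_sub_add_left_eq_sub, ← sub_smul] at h1
    exact hu (Set.mem_biUnion hU ((U.smul_mem_iff (sub_ne_zero.2 hne)).1 h1))
  have hfin : (⋃ U ∈ 𝒲, {t : ℝ | c + t • u ∈ U}).Finite :=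
    Set.Finite.biUnion 𝒲.finite_toSet hbad
  have hpos : 0 < ε / (1 + ‖u‖) := by positivity
  obtain ⟨t, ht, htn⟩ := (Set.Ioo_infinite hpos).exists_notMem_finite hfin
  refine ⟨c + t • u, fun i => ?_, fun T hT => ?_⟩
  · simp only [Pi.add_apply, Pi.smul_apply, smul_eq_mul, add_sub_cancel_left, abs_mul]
    rw [abs_of_pos ht.1]
    have h1 : |u i| ≤ ‖u‖ := norm_le_pi_norm u i
    have h2 := (lt_div_iff₀ (by positivity)).1 ht.2
    nlinarith [mul_le_mul_of_nonneg_left h1 ht.1.le, ht.1]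
  · rcases hW T with h | h
    · exfalso
      obtain ⟨x, hx⟩ := hT
      refine htn (Set.mem_biUnion (x := W T) ?_ ⟨x, fun i hi => sub_eq_zero.1 (hx i hi)⟩)
      simp [h𝒲, h]
    · exact h

section Cells
variable {ι : Type} {d : ℕ} (φ : ι → (Fin d → ℝ) →ₗ[ℝ] ℝ) (c : ι → ℝ) (S : Finset ι)

lemma affVal_add_smul (i : ι) (x w : Fin d → ℝ) (t : ℝ) :
    affVal φ c i (x + t • w) = affVal φ c i x + t * φ i w := by
  simp only [affVal, map_add, map_smul, smul_eq_mul]; ring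

/-- `y` lies in the closed cell whose relative interior contains `x`. -/
def InCell (x y : Fin d → ℝ) : Prop :=
  ∀ i ∈ S, (affVal φ c i x = 0 → affVal φ c i y = 0) ∧
    (0 < affVal φ c i x → 0 ≤ affVal φ c i y) ∧ (affVal φ c i x < 0 → affVal φ c i y ≤ 0)

/-- The hyperplanes of `S` through `x`. -/
noncomputable def zeroSet (x : Fin d → ℝ) : Finset ι :=
  open Classical in S.filter fun i => affVal φ c i x = 0

variable {φ c S}

lemma mem_zeroSet {x : Fin d → ℝ} {i : ι} :
    i ∈ zeroSet φ c S x ↔ i ∈ S ∧ affVal φ c i x = 0 := by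
  classical
  simp [zeroSet]

lemma InCell.refl (x : Fin d → ℝ) : InCell φ c S x x :=
  fun _ _ => ⟨id, le_of_lt, le_of_lt⟩

lemma InCell.trans {x y z : Fin d → ℝ} (h1 : InCell φ c S x y) (h2 : InCell φ c S y z) :
    InCell φ c S x z := by
  intro i hi
  obtain ⟨a1, a2, a3⟩ := h1 i hi
  obtain ⟨b1, b2, b3⟩ := h2 i hi
  refine ⟨fun h => b1 (a1 h), fun h => ?_, fun h => ?_⟩
  · rcases (a2 h).lt_or_eq with h' | h'
    · exact b2 h'
    · exact (b1 h'.symm).ge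
  · rcases (a3 h).lt_or_eq with h' | h'
    · exact b3 h'
    · exact (b1 h').le

lemma InCell.zeroSet_subset {x y : Fin d → ℝ} (h : InCell φ c S x y) :
    zeroSet φ c S x ⊆ zeroSet φ c S y := by
  intro i hi
  rw [mem_zeroSet] at hi ⊢
  exact ⟨hi.1, (h i hi.1).1 hi.2⟩

lemma InCell.sign_eq {x y : Fin d → ℝ} (h : InCell φ c S x y) {i : ι} (hi : i ∈ S)
    (hy : affVal φ c i y ≠ 0) :
    SignType.sign (affVal φ c i x) = SignType.sign (affVal φ c i y) := by
  obtain ⟨a1, a2, a3⟩ := h i hi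
  rcases lt_trichotomy (affVal φ c i x) 0 with h' | h' | h'
  · rw [sign_neg h', sign_neg (lt_of_le_of_ne (a3 h') hy)]
  · exact absurd (a1 h') hy
  · rw [sign_pos h', sign_pos (lt_of_le_of_ne (a2 h') hy.symm)]

lemma InCell.of_sign_eq {x x' y : Fin d → ℝ} (h : InCell φ c S x y)
    (hs : ∀ i ∈ S, SignType.sign (affVal φ c i x) = SignType.sign (affVal φ c i x')) :
    InCell φ c S x' y := by
  intro i hi
  obtain ⟨a1, a2, a3⟩ := h i hi
  have := hs i hi
  refine ⟨fun h => a1 ?_, fun h => a2 ?_, fun h => a3 ?_⟩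
  · rwa [h, sign_zero, sign_eq_zero_iff] at this
  · rwa [sign_pos h, sign_eq_one_iff] at this
  · rwa [sign_neg h, sign_eq_neg_one_iff] at this

lemma InCell.mul_nonneg {x y z : Fin d → ℝ} (h1 : InCell φ c S x y) (h2 : InCell φ c S x z)
    {i : ι} (hi : i ∈ S) : 0 ≤ affVal φ c i y * affVal φ c i z := by
  obtain ⟨a1, a2, a3⟩ := h1 i hi
  obtain ⟨b1, b2, b3⟩ := h2 i hi
  rcases lt_trichotomy (affVal φ c i x) 0 with h | h | h
  · exact mul_nonneg_of_nonpos_of_nonpos (a3 h) (b3 h)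
  · rw [a1 h, zero_mul]
  · exact _root_.mul_nonneg (a2 h) (b2 h)

/-- Travel along `w` until the first hyperplane approached is reached; the box guarantees that there
is one. No sign flips before that, and the hyperplanes through `x` are kept since `w` is parallel to
them. -/
lemma exists_exit {Bx : Finset ι} (hB : Bx ⊆ S) (hbox : ∀ w ≠ 0, ∃ j ∈ Bx, φ j w < 0)
    {x w : Fin d → ℝ} (hx : ∀ j ∈ Bx, 0 ≤ affVal φ c j x) (hw : w ≠ 0)
    (hz : ∀ i ∈ zeroSet φ c S x, φ i w = 0) :
    ∃ t : ℝ, 0 < t ∧ InCell φ c S x (x + t • w) ∧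
      (zeroSet φ c S x).card < (zeroSet φ c S (x + t • w)).card := by
  classical
  set N := S.filter fun i => affVal φ c i x * φ i w < 0 with hN
  have hne : N.Nonempty := by
    obtain ⟨j, hj, hjw⟩ := hbox w hw
    refine ⟨j, mem_filter.2 ⟨hB hj, mul_neg_of_pos_of_neg (lt_of_le_of_ne (hx j hj) ?_) hjw⟩⟩
    intro h0
    exact hjw.ne (hz j (mem_zeroSet.2 ⟨hB hj, h0.symm⟩))
  obtain ⟨i0, hi0, hmin⟩ := exists_min_image N (fun i => -(affVal φ c i x) / φ i w) hne
  have hi0' := mem_filter.1 hi0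
  have hφ0 : φ i0 w ≠ 0 := by intro h; simp [h] at hi0'
  have htpos : 0 < -(affVal φ c i0 x) / φ i0 w := by
    rw [show -(affVal φ c i0 x) / φ i0 w = -(affVal φ c i0 x * φ i0 w) / (φ i0 w * φ i0 w) by
      field_simp]
    exact div_pos (neg_pos.2 hi0'.2) (mul_self_pos.2 hφ0)
  set t := -(affVal φ c i0 x) / φ i0 w with ht
  have hcell : InCell φ c S x (x + t • w) := by
    intro i hi
    rw [affVal_add_smul]
    refine ⟨fun h => ?_, fun h => ?_, fun h => ?_⟩
    · rw [h, hz i (mem_zeroSet.2 ⟨hi, h⟩), mul_zero, add_zero]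
    · by_cases hneg : φ i w < 0
      · have := hmin i (mem_filter.2 ⟨hi, mul_neg_of_pos_of_neg h hneg⟩)
        rw [le_div_iff_of_neg hneg] at this
        linarith
      · have := mul_nonneg htpos.le (not_lt.1 hneg)
        linarith
    · by_cases hpos : 0 < φ i w
      · have := hmin i (mem_filter.2 ⟨hi, mul_neg_of_neg_of_pos h hpos⟩)
        rw [le_div_iff₀ hpos] at this
        linarith
      · have := mul_nonpos_of_nonneg_of_nonpos htpos.le (not_lt.1 hpos)
        linarith
  refine ⟨t, htpos, hcell, card_lt_card ⟨hcell.zeroSet_subset, fun hsub => ?_⟩⟩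
  have h1 : i0 ∈ zeroSet φ c S (x + t • w) := by
    refine mem_zeroSet.2 ⟨hi0'.1, ?_⟩
    rw [affVal_add_smul, ht, div_mul_cancel₀ _ hφ0, add_neg_cancel]
  have h2 := (mem_zeroSet.1 (hsub h1)).2
  simp [h2] at hi0'

lemma SimpleArrangement.card_le (h : SimpleArrangement φ c) {T : Finset ι}
    (hT : ∃ x, ∀ i ∈ T, affVal φ c i x = 0) : T.card ≤ d := by
  classical
  have hli : LinearIndependent ℝ (fun i : T => φ i) := by
    rw [Fintype.linearIndependent_iff]
    intro g hg i
    have := h T hT (fun i => if h : i ∈ T then g ⟨i, h⟩ else 0) (by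
      rw [← hg, ← sum_coe_sort T]
      exact sum_congr rfl fun i _ => by simp) i i.2
    simpa using this
  have := hli.fintype_card_le_finrank
  rw [Fintype.card_coe, Module.finrank_linearMap] at this
  simpa using this

lemma SimpleArrangement.eq_zero (h : SimpleArrangement φ c) {T : Finset ι}
    (hT : ∃ x, ∀ i ∈ T, affVal φ c i x = 0) (hc : T.card = d) (w : Fin d → ℝ)
    (hw : ∀ i ∈ T, φ i w = 0) : w = 0 := by
  have hspan := span_eq_top_of_card φ T (by rw [hc, Module.finrank_linearMap]; simp) (h T hT)
  have hall : ∀ f : (Fin d → ℝ) →ₗ[ℝ] ℝ, f w = 0 := by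
    intro f
    have hf : f ∈ Submodule.span ℝ (φ '' T) := hspan ▸ Submodule.mem_top
    have hle : Submodule.span ℝ (φ '' T) ≤ LinearMap.ker (LinearMap.applyₗ (R := ℝ) (M₂ := ℝ) w) := by
      rw [Submodule.span_le]
      rintro _ ⟨i, hi, rfl⟩
      exact hw i hi
    exact hle hf
  ext j
  exact hall (LinearMap.proj j)

lemma exists_direction {T : Finset ι} (hc : T.card < d) : ∃ w : Fin d → ℝ, w ≠ 0 ∧
    ∀ i ∈ T, φ i w = 0 := by
  let L : (Fin d → ℝ) →ₗ[ℝ] (T → ℝ) := LinearMap.pi fun i => φ i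
  have : LinearMap.ker L ≠ ⊥ := LinearMap.ker_ne_bot_of_finrank_lt (by simpa using hc)
  obtain ⟨w, hw, hne⟩ := (Submodule.ne_bot_iff _).1 this
  exact ⟨w, hne, fun i hi => congrFun (LinearMap.mem_ker.1 hw) ⟨i, hi⟩⟩

lemma InCell.region {Bx : Finset ι} (hB : Bx ⊆ S) {x y : Fin d → ℝ} (h : InCell φ c S x y)
    (hx : ∀ j ∈ Bx, 0 ≤ affVal φ c j x) : ∀ j ∈ Bx, 0 ≤ affVal φ c j y := by
  intro j hj
  rcases (hx j hj).lt_or_eq with h' | h'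
  · exact (h j (hB hj)).2.1 h'
  · exact ((h j (hB hj)).1 h'.symm).ge

/-- Every exit puts at least one more hyperplane through the point, and simplicity allows at most
`d`; `n` bounds how many are still missing. -/
lemma exists_vertex (h : SimpleArrangement φ c) {Bx : Finset ι} (hB : Bx ⊆ S)
    (hbox : ∀ w ≠ 0, ∃ j ∈ Bx, φ j w < 0) : ∀ (n : ℕ) (x : Fin d → ℝ),
    (∀ j ∈ Bx, 0 ≤ affVal φ c j x) → d ≤ (zeroSet φ c S x).card + n →
    ∃ y, InCell φ c S x y ∧ (zeroSet φ c S y).card = d := by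
  intro n
  induction n with
  | zero =>
    intro x hx hd
    exact ⟨x, InCell.refl x, le_antisymm (h.card_le ⟨x, fun i hi => (mem_zeroSet.1 hi).2⟩) hd⟩
  | succ n ih =>
    intro x hx hd
    by_cases hlt : (zeroSet φ c S x).card < d
    · obtain ⟨w, hw, hz⟩ := exists_direction (φ := φ) hlt
      obtain ⟨t, -, hcell, hcard⟩ := exists_exit hB hbox hx hw hz
      obtain ⟨y, hy, hyc⟩ := ih _ (hcell.region hB hx) (by omega)
      exact ⟨y, hcell.trans hy, hyc⟩
    · exact ⟨x, InCell.refl x, le_antisymm (h.card_le ⟨x, fun i hi => (mem_zeroSet.1 hi).2⟩)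
        (not_lt.1 hlt)⟩

lemma SimpleArrangement.vertex_unique (h : SimpleArrangement φ c) {T : Finset ι} (hc : T.card = d)
    {x y : Fin d → ℝ} (hx : ∀ i ∈ T, affVal φ c i x = 0) (hy : ∀ i ∈ T, affVal φ c i y = 0) :
    x = y := by
  refine sub_eq_zero.1 (h.eq_zero ⟨x, hx⟩ hc _ fun i hi => ?_)
  have h1 := hx i hi
  have h2 := hy i hi
  unfold affVal at h1 h2
  rw [map_sub]; linarith

variable (φ c)

/-- A common zero of the functionals indexed by `T`, if there is one. -/
noncomputable def commonZero (T : Finset ι) : Fin d → ℝ :=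
  open Classical in if h : ∃ y, ∀ i ∈ T, affVal φ c i y = 0 then h.choose else 0

/-- The vertices of the arrangement. -/
noncomputable def vertexSet [Fintype ι] : Finset (Fin d → ℝ) :=
  -- Subfamilies without a common zero contribute the default `0`. This is harmless: only an upper
  -- bound on the size and the presence of all genuine vertices are used.
  open Classical in (powersetCard d univ).image (commonZero φ c)

variable {φ c}

lemma SimpleArrangement.commonZero_eq (h : SimpleArrangement φ c) {T : Finset ι} (hc : T.card = d)
    {x : Fin d → ℝ} (hx : ∀ i ∈ T, affVal φ c i x = 0) : commonZero φ c T = x := by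
  have hex : ∃ y, ∀ i ∈ T, affVal φ c i y = 0 := ⟨x, hx⟩
  rw [commonZero, dif_pos hex]
  exact h.vertex_unique hc hex.choose_spec hx

lemma card_vertexSet_le [Fintype ι] : (vertexSet φ c).card ≤ Fintype.card ι ^ d := by
  classical
  refine card_image_le.trans ?_
  rw [card_powersetCard, card_univ]
  exact Nat.choose_le_pow _ _

/-- A finite family of simplices that covers the region cut out by the box and each member of which
lies in a closed cell of the arrangement `S`. -/
lemma exists_triangulation [Fintype ι] [DecidableEq ι] (hd : 1 ≤ d) (h : SimpleArrangement φ c)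
    {Bx : Finset ι} (hB : Bx ⊆ S) (hbox : ∀ w ≠ 0, ∃ j ∈ Bx, φ j w < 0) :
    ∃ 𝒯 : Finset (Finset (Fin d → ℝ)), 𝒯.card ≤ S.card ^ d * 3 ^ (d * (d + 1)) ∧
      ∀ p, (∀ j ∈ Bx, 0 ≤ affVal φ c j p) → ∃ τ ∈ 𝒯, p ∈ convexHull ℝ (τ : Set (Fin d → ℝ)) ∧
        τ.card ≤ d + 1 ∧ τ ⊆ vertexSet φ c ∧
        ∀ u ∈ τ, ∀ u' ∈ τ, ∀ i ∈ S, 0 ≤ affVal φ c i u * affVal φ c i u' := by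
  classical
  set σ : (Fin d → ℝ) → ι → SignType :=
    fun x i => if i ∈ S then SignType.sign (affVal φ c i x) else 0 with hσ
  have hσS : ∀ x x', σ x = σ x' →
      ∀ i ∈ S, SignType.sign (affVal φ c i x) = SignType.sign (affVal φ c i x') := by
    intro x x' he i hi
    simpa [hσ, hi] using congrFun he i
  -- The vertex assigned to a cell depends only on the sign vector of the cell. This makes the
  -- number of simplices finite and countable.
  have hv : ∀ τ : ι → SignType, ∃ y, ∀ x, σ x = τ → (∀ j ∈ Bx, 0 ≤ affVal φ c j x) →
      InCell φ c S x y ∧ (zeroSet φ c S y).card = d := by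
    intro τ
    by_cases hex : ∃ x, σ x = τ ∧ ∀ j ∈ Bx, 0 ≤ affVal φ c j x
    · obtain ⟨x, hx, hxB⟩ := hex
      obtain ⟨y, hy, hyc⟩ := exists_vertex h hB hbox d x hxB (by omega)
      exact ⟨y, fun x' hx' _ => ⟨hy.of_sign_eq (hσS x x' (hx.trans hx'.symm)), hyc⟩⟩
    · exact ⟨0, fun x hx hxB => absurd ⟨x, hx, hxB⟩ hex⟩
  choose vtx hvtx using hv
  have hzle : ∀ x, (zeroSet φ c S x).card ≤ d := fun x =>
    h.card_le ⟨x, fun i hi => (mem_zeroSet.1 hi).2⟩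
  have hvv : ∀ x, (∀ j ∈ Bx, 0 ≤ affVal φ c j x) → (zeroSet φ c S x).card = d →
      vtx (σ x) = x := fun x hx hc =>
    h.vertex_unique hc
      (fun i hi => (mem_zeroSet.1 ((hvtx (σ x) x rfl hx).1.zeroSet_subset hi)).2)
      (fun i hi => (mem_zeroSet.1 hi).2)
  -- Shoot from the assigned vertex of the cell through `x` until the ray leaves into a face of
  -- smaller dimension.
  have hn : ∀ x, ∃ x', (∀ j ∈ Bx, 0 ≤ affVal φ c j x) → InCell φ c S x x' ∧
      ((zeroSet φ c S x).card < d → (zeroSet φ c S x).card < (zeroSet φ c S x').card ∧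
        x ∈ segment ℝ (vtx (σ x)) x') := by
    intro x
    by_cases hx : ∀ j ∈ Bx, 0 ≤ affVal φ c j x
    swap
    · exact ⟨x, fun h => absurd h hx⟩
    by_cases hlt : (zeroSet φ c S x).card < d
    · obtain ⟨hy, hyc⟩ := hvtx (σ x) x rfl hx
      set y := vtx (σ x)
      have hne : x - y ≠ 0 := by
        intro h0
        rw [sub_eq_zero.1 h0] at hlt
        omega
      obtain ⟨t, ht, hcell, hcard⟩ := exists_exit hB hbox hx hne (fun i hi => by
        have h1 := (mem_zeroSet.1 hi).2
        have h2 := (hy i (mem_zeroSet.1 hi).1).1 h1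
        unfold affVal at h1 h2
        rw [map_sub]; linarith)
      refine ⟨x + t • (x - y), fun _ => ⟨hcell, fun _ => ⟨hcard, ?_⟩⟩⟩
      refine ⟨t / (1 + t), 1 / (1 + t), by positivity, by positivity, by field_simp; ring, ?_⟩
      ext j
      simp only [Pi.add_apply, Pi.smul_apply, Pi.sub_apply, smul_eq_mul]
      field_simp
      ring
    · exact ⟨x, fun _ => ⟨InCell.refl x, fun h => absurd h hlt⟩⟩
  choose nxt hnxt using hn
  set ch : (Fin d → ℝ) → ℕ → Fin d → ℝ := fun p k => nxt^[k] p with hch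
  have hchs : ∀ p k, ch p (k + 1) = nxt (ch p k) := fun p k => Function.iterate_succ_apply' nxt k p
  have hreg : ∀ p, (∀ j ∈ Bx, 0 ≤ affVal φ c j p) → ∀ k, ∀ j ∈ Bx, 0 ≤ affVal φ c j (ch p k) := by
    intro p hp k
    induction k with
    | zero => exact hp
    | succ k ih =>
      rw [hchs]
      exact (hnxt _ ih).1.region hB ih
  have hcell : ∀ p, (∀ j ∈ Bx, 0 ≤ affVal φ c j p) → ∀ k m,
      InCell φ c S (ch p k) (ch p (k + m)) := by
    intro p hp k m
    induction m with
    | zero => exact InCell.refl _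
    | succ m ih =>
      rw [← add_assoc, hchs]
      exact ih.trans (hnxt _ (hreg p hp _)).1
  have hcard : ∀ p, (∀ j ∈ Bx, 0 ≤ affVal φ c j p) → ∀ k,
      min k d ≤ (zeroSet φ c S (ch p k)).card := by
    intro p hp k
    induction k with
    | zero => simp
    | succ k ih =>
      have h1 := hnxt _ (hreg p hp k)
      rw [hchs]
      by_cases hlt : (zeroSet φ c S (ch p k)).card < d
      · have := (h1.2 hlt).1; omega
      · have := card_le_card h1.1.zeroSet_subset; omega
  have hlast : ∀ p, (∀ j ∈ Bx, 0 ≤ affVal φ c j p) → (zeroSet φ c S (ch p d)).card = d :=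
    fun p hp => le_antisymm (hzle _) (by simpa using hcard p hp d)
  -- Backwards from the vertex `ch p d`: each point of the chain lies on the segment from the
  -- assigned vertex of its cell to the next point.
  have hull : ∀ p, (∀ j ∈ Bx, 0 ≤ affVal φ c j p) → ∀ m ≤ d,
      ch p (d - m) ∈ convexHull ℝ (Set.range fun k : Fin (d + 1) => vtx (σ (ch p k))) := by
    intro p hp m
    have hmem : ∀ k ≤ d, vtx (σ (ch p k)) ∈
        convexHull ℝ (Set.range fun k : Fin (d + 1) => vtx (σ (ch p k))) := fun k hk =>
      subset_convexHull _ _ ⟨⟨k, by omega⟩, rfl⟩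
    induction m with
    | zero =>
      intro _
      have := hmem d le_rfl
      rwa [hvv _ (hreg p hp d) (hlast p hp)] at this
    | succ m ih =>
      intro hm
      by_cases hlt : (zeroSet φ c S (ch p (d - (m + 1)))).card < d
      · have h1 := ((hnxt _ (hreg p hp (d - (m + 1)))).2 hlt).2
        rw [← hchs, show d - (m + 1) + 1 = d - m by omega] at h1
        exact (convex_convexHull ℝ _).segment_subset (hmem _ (by omega)) (ih (by omega)) h1
      · have := hmem (d - (m + 1)) (by omega)
        rwa [hvv _ (hreg p hp _) (le_antisymm (hzle _) (not_lt.1 hlt))] at this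
  have hen : ∀ T : Finset ι, ∃ en : ι → Fin d, T.card = d → Set.InjOn en T := by
    intro T
    by_cases hT : T.card = d
    · let e := T.equivFinOfCardEq hT
      refine ⟨fun i => if hi : i ∈ T then e ⟨i, hi⟩ else ⟨0, hd⟩, fun _ i hi j hj hij => ?_⟩
      rw [mem_coe] at hi hj
      simpa [hi, hj] using hij
    · exact ⟨fun _ => ⟨0, hd⟩, fun h => absurd h hT⟩
  choose en hen using hen
  -- A simplex is encoded by the `d` hyperplanes `T` through the last point of the chain and the
  -- signs on `T` of all `d + 1` points. Off `T` every point of the chain has the same signs as the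
  -- last one. This gives the factor `3 ^ (d * (d + 1))`.
  let dec : Finset ι × (Fin (d + 1) → Fin d → SignType) → Finset (Fin d → ℝ) := fun Te =>
    univ.image fun k : Fin (d + 1) => vtx fun i => if i ∈ S then
      (if i ∈ Te.1 then Te.2 k (en Te.1 i) else SignType.sign (affVal φ c i (commonZero φ c Te.1)))
      else 0
  refine ⟨(powersetCard d S ×ˢ univ).image dec, ?_, fun p hp => ?_⟩
  · refine card_image_le.trans ?_
    rw [card_product, card_powersetCard]
    refine Nat.mul_le_mul (Nat.choose_le_pow _ _) ?_
    have : Fintype.card SignType = 3 := by decide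
    rw [card_univ, Fintype.card_fun, Fintype.card_fun, Fintype.card_fin, Fintype.card_fin, this,
      ← pow_mul]
  set T := zeroSet φ c S (ch p d) with hT
  have hTS : T ⊆ S := filter_subset _ _
  have hpt : commonZero φ c T = ch p d :=
    h.commonZero_eq (hlast p hp) fun i hi => (mem_zeroSet.1 hi).2
  set e : Fin (d + 1) → Fin d → SignType := fun k j =>
    if hj : ∃ i ∈ T, en T i = j then σ (ch p k) hj.choose else 0 with he
  have hedec : ∀ k : Fin (d + 1), ∀ i ∈ T, e k (en T i) = σ (ch p k) i := by
    intro k i hi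
    have hj : ∃ i' ∈ T, en T i' = en T i := ⟨i, hi, rfl⟩
    rw [he]
    dsimp only
    rw [dif_pos hj]
    congr 1
    exact hen T (hlast p hp) hj.choose_spec.1 hi hj.choose_spec.2
  have hdec : dec (T, e) = univ.image fun k : Fin (d + 1) => vtx (σ (ch p k)) := by
    change (univ.image fun k : Fin (d + 1) => vtx fun i => if i ∈ S then
      (if i ∈ T then e k (en T i) else SignType.sign (affVal φ c i (commonZero φ c T)))
      else 0) = _
    congr 1
    ext1 k
    congr 1
    ext1 i
    by_cases hi : i ∈ S
    · rw [if_pos hi]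
      by_cases hiT : i ∈ T
      · rw [if_pos hiT, hedec k i hiT]
      · rw [if_neg hiT, hpt]
        have hk : (k : ℕ) + (d - k) = d := by have := k.2; omega
        have h1 := hcell p hp k (d - k)
        rw [hk] at h1
        rw [← h1.sign_eq hi (fun h0 => hiT (mem_zeroSet.2 ⟨hi, h0⟩))]
        simp [hσ, hi]
    · rw [if_neg hi]
      simp [hσ, hi]
  have hcellv : ∀ k : ℕ, InCell φ c S p (vtx (σ (ch p k))) := by
    intro k
    have h1 := hcell p hp 0 k
    rw [zero_add] at h1
    exact h1.trans (hvtx _ _ rfl (hreg p hp k)).1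
  refine ⟨dec (T, e), mem_image.2 ⟨(T, e), mem_product.2 ⟨mem_powersetCard.2 ⟨hTS, hlast p hp⟩,
    mem_univ _⟩, rfl⟩, ?_⟩
  rw [hdec]
  refine ⟨?_, card_image_le.trans (by simp), ?_, ?_⟩
  · have := hull p hp d le_rfl
    rw [Nat.sub_self] at this
    simpa [hch] using this
  · intro u hu
    obtain ⟨k, -, rfl⟩ := mem_image.1 hu
    obtain ⟨-, h2⟩ := hvtx _ _ rfl (hreg p hp k)
    exact mem_image.2 ⟨_, mem_powersetCard.2 ⟨subset_univ _, h2⟩,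
      h.commonZero_eq h2 fun i hi => (mem_zeroSet.1 hi).2⟩
  · intro u hu u' hu' i hi
    obtain ⟨k, -, rfl⟩ := mem_image.1 hu
    obtain ⟨k', -, rfl⟩ := mem_image.1 hu'
    exact (hcellv k).mul_nonneg (hcellv k') hi

end Cells

/-! ### Cuttings -/

/-- Greedy choice: by averaging, some element lies in at least a fraction `δ` of the sets not yet
hit, so each step multiplies their number by at most `1 - δ`. -/
lemma exists_hitting_set {κ : Type} [Fintype κ] [DecidableEq κ] [Nonempty κ]
    (𝓕 : Finset (Finset κ)) (δ : ℝ) (hδ : δ ≤ 1)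
    (h : ∀ X ∈ 𝓕, δ * Fintype.card κ ≤ X.card) (s : ℕ) :
    ∃ S : Finset κ, S.card ≤ s ∧
      ((𝓕.filter fun X => Disjoint S X).card : ℝ) ≤ (1 - δ) ^ s * 𝓕.card := by
  induction s with
  | zero => exact ⟨∅, by simp, by simp⟩
  | succ s ih =>
    obtain ⟨S, hS, hc⟩ := ih
    set 𝓖 := 𝓕.filter fun X => Disjoint S X with h𝓖
    have havg : ∃ i : κ, δ * 𝓖.card ≤ ((𝓖.filter fun X => i ∈ X).card : ℝ) := by
      by_contra! hcon
      have h1 : ∑ i : κ, ((𝓖.filter fun X => i ∈ X).card : ℝ) < ∑ _i : κ, δ * 𝓖.card :=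
        sum_lt_sum_of_nonempty univ_nonempty fun i _ => hcon i
      have h2 := sum_card_bipartiteAbove_eq_sum_card_bipartiteBelow (s := (univ : Finset κ))
        (t := 𝓖) (fun (i : κ) (X : Finset κ) => i ∈ X)
      simp only [bipartiteAbove, bipartiteBelow, filter_mem_eq_inter, univ_inter] at h2
      have h3 : ∑ i : κ, ((𝓖.filter fun X => i ∈ X).card : ℝ) = ∑ X ∈ 𝓖, (X.card : ℝ) := by
        exact_mod_cast h2
      have h4 : ∑ _X ∈ 𝓖, δ * Fintype.card κ ≤ ∑ X ∈ 𝓖, (X.card : ℝ) :=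
        sum_le_sum fun X hX => h X (mem_filter.1 hX).1
      rw [sum_const, nsmul_eq_mul] at h4
      rw [sum_const, nsmul_eq_mul, card_univ] at h1
      linarith
    obtain ⟨i, hi⟩ := havg
    refine ⟨insert i S, (card_insert_le _ _).trans (by omega), ?_⟩
    have h5 : (𝓕.filter fun X => Disjoint (insert i S) X) = 𝓖.filter fun X => ¬ i ∈ X := by
      ext X
      simp only [h𝓖, mem_filter, disjoint_insert_left]
      tauto
    have h6 := card_filter_add_card_filter_not (s := 𝓖) (fun X => i ∈ X)
    have h7 : ((𝓖.filter fun X => i ∈ X).card : ℝ) + (𝓖.filter fun X => ¬ i ∈ X).card = 𝓖.card := by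
      exact_mod_cast h6
    rw [h5]
    calc ((𝓖.filter fun X => ¬ i ∈ X).card : ℝ) ≤ (1 - δ) * 𝓖.card := by linarith
      _ ≤ (1 - δ) * ((1 - δ) ^ s * 𝓕.card) := mul_le_mul_of_nonneg_left hc (by linarith)
      _ = (1 - δ) ^ (s + 1) * 𝓕.card := by ring

lemma exists_uniform_gap {κ α : Type} [Fintype κ] (P : Finset α) (f : κ → α → ℝ)
    (h : ∀ k, ∀ p ∈ P, f k p ≠ 0) : ∃ ε : ℝ, 0 < ε ∧ ε ≤ 1 ∧ ∀ k, ∀ p ∈ P, ε ≤ |f k p| := by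
  classical
  rcases ((univ : Finset κ) ×ˢ P).eq_empty_or_nonempty with he | hne
  · refine ⟨1, one_pos, le_rfl, fun k p hp => ?_⟩
    have : (k, p) ∈ (univ : Finset κ) ×ˢ P := mem_product.2 ⟨mem_univ _, hp⟩
    rw [he] at this
    simp at this
  · obtain ⟨⟨k, p⟩, hkp, hmin⟩ := exists_min_image _ (fun kp : κ × α => |f kp.1 kp.2|) hne
    refine ⟨min 1 |f k p|, lt_min one_pos (abs_pos.2 (h k p (mem_product.1 hkp).2)),
      min_le_left _ _, fun k' p' hp' => (min_le_right _ _).trans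
        (hmin (k', p') (mem_product.2 ⟨mem_univ _, hp'⟩))⟩

lemma exists_large_fiber {α β : Type} [DecidableEq β] (P : Finset α) (𝒯 : Finset β) (f : α → β)
    (hf : ∀ p ∈ P, f p ∈ 𝒯) (hP : P.Nonempty) :
    ∃ τ ∈ 𝒯, P.card ≤ (P.filter fun p => f p = τ).card * 𝒯.card := by
  obtain ⟨p, hp⟩ := hP
  obtain ⟨τ, hτ, hmax⟩ := exists_max_image 𝒯 (fun τ => (P.filter fun p => f p = τ).card)
    ⟨_, hf p hp⟩
  refine ⟨τ, hτ, ?_⟩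
  rw [card_eq_sum_card_fiberwise hf, mul_comm, ← smul_eq_mul]
  exact sum_le_card_nsmul _ _ _ hmax

lemma affVal_nonneg_of_mem_convexHull {ι : Type} {d : ℕ} {φ : ι → (Fin d → ℝ) →ₗ[ℝ] ℝ}
    {c : ι → ℝ} {i : ι} {τ : Set (Fin d → ℝ)} (h : ∀ u ∈ τ, 0 ≤ affVal φ c i u)
    {x : Fin d → ℝ} (hx : x ∈ convexHull ℝ τ) : 0 ≤ affVal φ c i x := by
  have hle : convexHull ℝ τ ⊆ {x | c i ≤ φ i x} :=
    convexHull_min (fun u hu => sub_nonneg.1 (h u hu)) (convex_halfSpace_ge (φ i).isLinear _)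
  exact sub_nonneg.2 (hle hx)

lemma affVal_nonpos_of_mem_convexHull {ι : Type} {d : ℕ} {φ : ι → (Fin d → ℝ) →ₗ[ℝ] ℝ}
    {c : ι → ℝ} {i : ι} {τ : Set (Fin d → ℝ)} (h : ∀ u ∈ τ, affVal φ c i u ≤ 0)
    {x : Fin d → ℝ} (hx : x ∈ convexHull ℝ τ) : affVal φ c i x ≤ 0 := by
  have hle : convexHull ℝ τ ⊆ {x | φ i x ≤ c i} :=
    convexHull_min (fun u hu => sub_nonpos.1 (h u hu)) (convex_halfSpace_le (φ i).isLinear _)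
  exact sub_nonpos.2 (hle hx)

/-- A large subset of `P` whose convex hull is met by few of the given hyperplanes. -/
lemma exists_low_crossing_subset {κ α : Type} [Fintype κ] [DecidableEq κ] [Nonempty κ] {d : ℕ}
    (hd : 1 ≤ d)
    (φ : κ → (Fin d → ℝ) →ₗ[ℝ] ℝ) (c : κ → ℝ) (v : α → Fin d → ℝ) (P : Finset α)
    (hP : P.Nonempty) (hne : ∀ k, ∀ p ∈ P, φ k (v p) ≠ c k) (δ : ℝ) (hδ0 : 0 ≤ δ) (hδ : δ ≤ 1)
    (s : ℕ) (hs : (1 - δ) ^ s * (((Fintype.card κ + 2 * d : ℕ) : ℝ) ^ d) ^ 2 < 1) :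
    ∃ B ⊆ P, P.card ≤ B.card * ((s + 2 * d) ^ d * 3 ^ (d * (d + 1))) ∧
      ∃ X : Finset κ, (X.card : ℝ) ≤ (d + 1) ^ 2 * (δ * Fintype.card κ) ∧
        ∀ k, k ∉ X → (∀ p ∈ B, c k < φ k (v p)) ∨ (∀ p ∈ B, φ k (v p) < c k) := by
  classical
  obtain ⟨ε, hε, hε1, hgap⟩ := exists_uniform_gap P (fun k p => φ k (v p) - c k)
    (fun k p hp => sub_ne_zero.2 (hne k p hp))
  obtain ⟨M, hM⟩ : ∃ M : ℝ, ∀ p ∈ P, ‖v p‖ ≤ M := by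
    obtain ⟨p, hp, hmax⟩ := exists_max_image P (fun p => ‖v p‖) hP
    exact ⟨_, hmax⟩
  let φ' : κ ⊕ (Fin d × Bool) → (Fin d → ℝ) →ₗ[ℝ] ℝ := Sum.elim φ
    fun jb => if jb.2 then LinearMap.proj jb.1 else -LinearMap.proj jb.1
  -- The offset `M + 1` leaves room for the perturbation: as `ε ≤ 1`, the perturbed box still
  -- contains all points of `P`.
  let c₀ : κ ⊕ (Fin d × Bool) → ℝ := Sum.elim c fun _ => -(M + 1)
  obtain ⟨c', hc', hsimple⟩ := exists_simple_perturbation φ' c₀ ε hε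
  set V := vertexSet φ' c' with hV
  have hVc : V.card ≤ (Fintype.card κ + 2 * d) ^ d := by
    refine card_vertexSet_le.trans (le_of_eq ?_)
    rw [Fintype.card_sum, Fintype.card_prod, Fintype.card_fin, Fintype.card_bool, mul_comm d]
  let X : (Fin d → ℝ) × (Fin d → ℝ) → Finset κ := fun uu =>
    univ.filter fun k => affVal φ' c' (Sum.inl k) uu.1 * affVal φ' c' (Sum.inl k) uu.2 < 0
  -- Pairs of vertices of the full arrangement that are separated by many hyperplanes. This family
  -- is fixed before the sample `S₀`, yet every simplex of the triangulation built from `S₀` has its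
  -- vertices in `V`.
  set 𝓕 := ((V ×ˢ V).image X).filter fun X => δ * Fintype.card κ ≤ X.card with h𝓕
  have h𝓕c : (𝓕.card : ℝ) ≤ (((Fintype.card κ + 2 * d : ℕ) : ℝ) ^ d) ^ 2 := by
    have h1 : 𝓕.card ≤ V.card * V.card :=
      (card_filter_le _ _).trans (card_image_le.trans (card_product _ _).le)
    have h2 := h1.trans (Nat.mul_le_mul hVc hVc)
    rw [sq]
    exact_mod_cast h2
  obtain ⟨S₀, hS₀, hhit⟩ := exists_hitting_set 𝓕 δ hδ (fun X hX => (mem_filter.1 hX).2) s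
  have hhit0 : (𝓕.filter fun X => Disjoint S₀ X) = ∅ := by
    rw [← card_eq_zero, ← Nat.lt_one_iff]
    have : ((𝓕.filter fun X => Disjoint S₀ X).card : ℝ) < 1 :=
      hhit.trans_lt (lt_of_le_of_lt
        (mul_le_mul_of_nonneg_left h𝓕c (pow_nonneg (by linarith) _)) hs)
    exact_mod_cast this
  set Bx : Finset (κ ⊕ (Fin d × Bool)) := univ.image Sum.inr with hBx
  set S := S₀.image Sum.inl ∪ Bx with hS
  have hSc : S.card ≤ s + 2 * d := by
    refine (card_union_le _ _).trans (add_le_add (card_image_le.trans hS₀) ?_)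
    refine card_image_le.trans ?_
    rw [card_univ, Fintype.card_prod, Fintype.card_fin, Fintype.card_bool, mul_comm]
  have hbox : ∀ w ≠ 0, ∃ j ∈ Bx, φ' j w < 0 := by
    intro w hw
    obtain ⟨j, hj⟩ := Function.ne_iff.1 hw
    rcases lt_or_gt_of_ne hj with h | h
    · exact ⟨Sum.inr (j, true), by simp [hBx], by simpa [φ'] using h⟩
    · exact ⟨Sum.inr (j, false), by simp [hBx], by simpa [φ'] using h⟩
  obtain ⟨𝒯, h𝒯c, h𝒯⟩ := exists_triangulation hd hsimple (S := S) subset_union_right hbox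
  have hregion : ∀ p ∈ P, ∀ j ∈ Bx, 0 ≤ affVal φ' c' j (v p) := by
    intro p hp j hj
    obtain ⟨⟨j, b⟩, -, rfl⟩ := mem_image.1 hj
    have h1 := (norm_le_pi_norm (v p) j).trans (hM p hp)
    rw [Real.norm_eq_abs, abs_le] at h1
    have h2 := (abs_lt.1 (hc' (Sum.inr (j, b)))).2
    simp only [c₀, Sum.elim_inr] at h2
    cases b <;> simp [affVal, φ'] <;> linarith [h1.1, h1.2]
  choose! simp₁ hs1 hs2 hs3 hs4 hs5 using h𝒯
  obtain ⟨τ, hτ, hfib⟩ := exists_large_fiber P 𝒯 (fun p => simp₁ (v p))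
    (fun p hp => hs1 _ (hregion p hp)) hP
  set B := P.filter fun p => simp₁ (v p) = τ with hB
  have hBP : B ⊆ P := filter_subset _ _
  refine ⟨B, hBP, hfib.trans (Nat.mul_le_mul le_rfl (h𝒯c.trans
    (Nat.mul_le_mul (Nat.pow_le_pow_left hSc d) le_rfl))), ?_⟩
  rcases B.eq_empty_or_nonempty with hBe | ⟨p₀, hp₀⟩
  · refine ⟨∅, by simp; positivity, fun k _ => Or.inl fun p hp => ?_⟩
    rw [hBe] at hp; simp at hp
  have hp₀' := mem_filter.1 hp₀
  have hr := hregion p₀ hp₀'.1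
  have hτc := hs3 _ hr
  have hτV := hs4 _ hr
  have hτS := hs5 _ hr
  rw [hp₀'.2] at hτc hτV hτS
  refine ⟨(τ ×ˢ τ).biUnion X, ?_, fun k hk => ?_⟩
  · have hXle : ∀ uu ∈ τ ×ˢ τ, ((X uu).card : ℝ) ≤ δ * Fintype.card κ := by
      intro uu huu
      obtain ⟨h1, h2⟩ := mem_product.1 huu
      by_contra! hcon
      have hmem : X uu ∈ 𝓕 := mem_filter.2
        ⟨mem_image.2 ⟨uu, mem_product.2 ⟨hτV h1, hτV h2⟩, rfl⟩, hcon.le⟩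
      have hnd : ¬ Disjoint S₀ (X uu) := by
        intro hdis
        have : X uu ∈ 𝓕.filter fun X => Disjoint S₀ X := mem_filter.2 ⟨hmem, hdis⟩
        rw [hhit0] at this
        simp at this
      obtain ⟨k, hk1, hk2⟩ := not_disjoint_iff.1 hnd
      have h3 := hτS _ h1 _ h2 (Sum.inl k) (mem_union_left _ (mem_image_of_mem _ hk1))
      exact absurd (mem_filter.1 hk2).2 (not_lt.2 h3)
    have h1 : (((τ ×ˢ τ).biUnion X).card : ℝ) ≤ ∑ uu ∈ τ ×ˢ τ, ((X uu).card : ℝ) := by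
      exact_mod_cast card_biUnion_le
    have h2 := sum_le_card_nsmul _ _ _ hXle
    rw [nsmul_eq_mul, card_product] at h2
    refine h1.trans (h2.trans (mul_le_mul_of_nonneg_right ?_ (by positivity)))
    rw [sq]
    exact_mod_cast Nat.mul_le_mul hτc hτc
  · have hside : (∀ u ∈ τ, 0 ≤ affVal φ' c' (Sum.inl k) u) ∨
        (∀ u ∈ τ, affVal φ' c' (Sum.inl k) u ≤ 0) := by
      by_contra! hcon
      obtain ⟨⟨u, hu, h1⟩, u', hu', h2⟩ := hcon
      exact hk (mem_biUnion.2 ⟨(u, u'), mem_product.2 ⟨hu, hu'⟩,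
        mem_filter.2 ⟨mem_univ _, mul_neg_of_neg_of_pos h1 h2⟩⟩)
    have hck := abs_lt.1 (hc' (Sum.inl k))
    simp only [c₀, Sum.elim_inl] at hck
    have hull : ∀ p ∈ B, v p ∈ convexHull ℝ (τ : Set (Fin d → ℝ)) := by
      intro p hp
      have hp' := mem_filter.1 hp
      have := hs2 _ (hregion p hp'.1)
      rwa [hp'.2] at this
    -- The perturbation is smaller than the gap `ε`, so being weakly on one side of the perturbed
    -- hyperplane forces being strictly on that side of the original one.
    rcases hside with h | h
    · refine Or.inl fun p hp => ?_
      have h1 : 0 ≤ φ k (v p) - c' (Sum.inl k) := affVal_nonneg_of_mem_convexHull h (hull p hp)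
      by_contra! hcon
      have h2 := hgap k p (hBP hp)
      rw [abs_of_nonpos (by linarith)] at h2
      linarith [hck.1]
    · refine Or.inr fun p hp => ?_
      have h1 : φ k (v p) - c' (Sum.inl k) ≤ 0 := affVal_nonpos_of_mem_convexHull h (hull p hp)
      by_contra! hcon
      have h2 := hgap k p (hBP hp)
      rw [abs_of_nonneg (by linarith)] at h2
      linarith [hck.2]

/-! ### Avoiding pairs -/

/-- Functionals identifying two given distinct points form a proper subspace, and finitely many
proper subspaces do not cover the dual space. -/
lemma GenPos.exists_functional_injOn {α : Type} {d : ℕ} (hd : 1 ≤ d) {v : α → Fin d → ℝ}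
    {P : Finset α} (h : GenPos v P) :
    ∃ f : (Fin d → ℝ) →ₗ[ℝ] ℝ, Set.InjOn (fun i => f (v i)) P := by
  classical
  let W : (Fin d → ℝ) → Submodule ℝ ((Fin d → ℝ) →ₗ[ℝ] ℝ) := fun w =>
    LinearMap.ker (LinearMap.applyₗ (R := ℝ) (M₂ := ℝ) w)
  set 𝒲 := ((P ×ˢ P).filter fun ij => v ij.1 ≠ v ij.2).image fun ij => W (v ij.1 - v ij.2) with h𝒲
  have htop : (⊤ : Submodule ℝ ((Fin d → ℝ) →ₗ[ℝ] ℝ)) ∉ 𝒲 := by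
    intro hmem
    obtain ⟨⟨i, j⟩, hij, he⟩ := mem_image.1 hmem
    refine (mem_filter.1 hij).2 (sub_eq_zero.1 ?_)
    ext l
    have : LinearMap.proj l ∈ W (v i - v j) := he ▸ Submodule.mem_top
    exact this
  obtain ⟨f, hf⟩ := (Set.ne_univ_iff_exists_notMem _).1 (Subspace.biUnion_ne_univ_of_top_notMem htop)
  refine ⟨f, fun i hi j hj hij => h.injOn hd hi hj ?_⟩
  by_contra hne
  refine hf (Set.mem_biUnion (x := W (v i - v j)) (mem_image.2 ⟨(i, j), mem_filter.2
    ⟨mem_product.2 ⟨hi, hj⟩, hne⟩, rfl⟩) ?_)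
  change f (v i - v j) = 0
  rw [map_sub, sub_eq_zero]
  exact hij

/-- The hyperplane through `d` points of `P` contains no further point of `P`. -/
lemma GenPos.exists_hyperplane {α : Type} {d : ℕ} {v : α → Fin d → ℝ}
    {P : Finset α} (h : GenPos v P) {D : Finset α} (hD : D ⊆ P) (hc : D.card = d) :
    ∃ (g : (Fin d → ℝ) →ₗ[ℝ] ℝ) (γ : ℝ), (∀ i ∈ D, g (v i) = γ) ∧
      ∀ p ∈ P, p ∉ D → g (v p) ≠ γ := by
  classical
  let L : (((Fin d → ℝ) × ℝ) →ₗ[ℝ] ℝ) →ₗ[ℝ] (D → ℝ) :=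
    LinearMap.pi fun i => LinearMap.applyₗ (R := ℝ) (M₂ := ℝ) ((v i, 1) : (Fin d → ℝ) × ℝ)
  -- The affine functionals have dimension `d + 1`, and vanishing on `D` is only `d` conditions.
  have hker : LinearMap.ker L ≠ ⊥ := LinearMap.ker_ne_bot_of_finrank_lt (by
    rw [Module.finrank_linearMap]
    simp [hc])
  obtain ⟨G, hG, hne⟩ := (Submodule.ne_bot_iff _).1 hker
  have hGD : ∀ i ∈ D, G (v i, 1) = 0 := fun i hi => congrFun (LinearMap.mem_ker.1 hG) ⟨i, hi⟩
  have hsplit : ∀ x : Fin d → ℝ, G (x, 1) = G (x, 0) + G (0, 1) := fun x => by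
    rw [← map_add]; simp
  refine ⟨G.comp (LinearMap.inl ℝ _ ℝ), -G (0, 1), fun i hi => ?_, fun p hp hpD he => hne ?_⟩
  · have := hGD i hi
    rw [hsplit] at this
    simp only [LinearMap.comp_apply, LinearMap.inl_apply]
    linarith
  · have hGp : G (v p, 1) = 0 := by
      simp only [LinearMap.comp_apply, LinearMap.inl_apply] at he
      rw [hsplit, he, neg_add_cancel]
    have hins : insert p D ⊆ P := insert_subset hp hD
    have hcard : (insert p D).card = d + 1 := by rw [card_insert_of_notMem hpD, hc]
    have hspan := span_eq_top_of_card (fun i => ((v i, 1) : (Fin d → ℝ) × ℝ)) (insert p D)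
      (by simp [hcard]) (h.lift _ hins hcard.le)
    have hle : Submodule.span ℝ ((fun i => ((v i, 1) : (Fin d → ℝ) × ℝ)) '' (insert p D : Finset α)) ≤
        LinearMap.ker G := by
      rw [Submodule.span_le]
      rintro _ ⟨i, hi, rfl⟩
      rw [mem_coe, mem_insert] at hi
      rcases hi with rfl | hi
      · exact hGp
      · exact hGD i hi
    rw [hspan, top_le_iff, LinearMap.ker_eq_top] at hle
    exact hle

lemma card_filter_supersets_le {α : Type} [DecidableEq α] (Q D : Finset α) (M : ℕ) :
    ((powersetCard M Q).filter fun R => D ⊆ R).card ≤ (Q.card - D.card).choose (M - D.card) := by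
  by_cases hD : D ⊆ Q
  · rw [← card_sdiff_of_subset hD, ← card_powersetCard]
    refine card_le_card_of_injOn (fun R => R \ D) (fun R hR => ?_) (fun R hR R' hR' he => ?_)
    · obtain ⟨h1, h2⟩ := mem_filter.1 hR
      obtain ⟨h3, h4⟩ := mem_powersetCard.1 h1
      exact mem_powersetCard.2 ⟨sdiff_subset_sdiff h3 subset_rfl, by
        rw [card_sdiff_of_subset h2, h4]⟩
    · have h1 := (mem_filter.1 hR).2
      have h2 := (mem_filter.1 hR').2
      dsimp only at he
      rw [← sdiff_union_of_subset h1, he, sdiff_union_of_subset h2]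
  · rw [filter_false_of_mem]
    · simp
    · intro R hR hDR
      exact hD (hDR.trans (mem_powersetCard.1 hR).1)

/-- A sparse `d`-uniform hypergraph has a large independent set. -/
lemma exists_independent_subset {α : Type} [DecidableEq α] {d : ℕ} (hd : 1 ≤ d) (Q : Finset α)
    (𝒳 : Finset (Finset α)) (h𝒳 : ∀ D ∈ 𝒳, D.card = d) (η : ℝ)
    (hη : (𝒳.card : ℝ) ≤ η * Q.card.choose d) (hη0 : 0 ≤ η) (m : ℕ) (hm : 2 * m ≤ Q.card)
    (hdm : d ≤ 2 * m) (hsmall : η * (2 * m : ℝ) ^ d ≤ m) :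
    ∃ A ⊆ Q, m ≤ A.card ∧ ∀ D ∈ 𝒳, ¬ D ⊆ A := by
  -- By double counting, some `2 * m`-subset contains at most the average number of edges. That
  -- number is at most `m` by `hsmall`, so deleting one point of each edge leaves `m` points.
  have havg : ∃ R ∈ powersetCard (2 * m) Q,
      ((𝒳.filter fun D => D ⊆ R).card : ℝ) ≤ η * (2 * m).choose d := by
    by_contra! hcon
    have hne : (powersetCard (2 * m) Q).Nonempty := powersetCard_nonempty.2 hm
    have h1 := sum_lt_sum_of_nonempty hne hcon
    rw [sum_const, card_powersetCard, nsmul_eq_mul] at h1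
    have h2 := sum_card_bipartiteAbove_eq_sum_card_bipartiteBelow (s := powersetCard (2 * m) Q)
        (t := 𝒳) (fun R D => D ⊆ R)
    simp only [bipartiteAbove, bipartiteBelow] at h2
    have h3 : ∑ D ∈ 𝒳, ((powersetCard (2 * m) Q).filter fun R => D ⊆ R).card ≤
        𝒳.card * (Q.card - d).choose (2 * m - d) := by
      rw [← smul_eq_mul]
      refine sum_le_card_nsmul _ _ _ fun D hD => ?_
      have := card_filter_supersets_le Q D (2 * m)
      rwa [h𝒳 D hD] at this
    rw [← h2] at h3
    have h4 : (∑ R ∈ powersetCard (2 * m) Q, ((𝒳.filter fun D => D ⊆ R).card : ℝ)) ≤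
        𝒳.card * (Q.card - d).choose (2 * m - d) := by exact_mod_cast h3
    have h5 : (Q.card.choose (2 * m) : ℝ) * (2 * m).choose d =
        Q.card.choose d * (Q.card - d).choose (2 * m - d) := by
      exact_mod_cast Nat.choose_mul (n := Q.card) hdm
    have h6 := mul_le_mul_of_nonneg_right hη
      (Nat.cast_nonneg (α := ℝ) ((Q.card - d).choose (2 * m - d)))
    nlinarith
  obtain ⟨R, hR, hbad⟩ := havg
  obtain ⟨hRQ, hRc⟩ := mem_powersetCard.1 hR
  have hb : (𝒳.filter fun D => D ⊆ R).card ≤ m := by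
    have h1 : ((2 * m).choose d : ℝ) ≤ (2 * m : ℝ) ^ d := by
      exact_mod_cast Nat.choose_le_pow (2 * m) d
    have := hbad.trans ((mul_le_mul_of_nonneg_left h1 hη0).trans hsmall)
    exact_mod_cast this
  have hpick : ∀ D : Finset α, ∃ i, D ∈ 𝒳 → i ∈ D := by
    intro D
    rcases D.eq_empty_or_nonempty with rfl | ⟨i, hi⟩
    · by_cases h0 : (∅ : Finset α) ∈ 𝒳
      · have := h𝒳 _ h0; simp at this; omega
      · have : Nonempty α := by
          have : 0 < R.card := by omega
          obtain ⟨i, -⟩ := card_pos.1 this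
          exact ⟨i⟩
        exact ⟨Classical.arbitrary α, fun h => absurd h h0⟩
    · exact ⟨i, fun _ => hi⟩
  choose pick hpick using hpick
  refine ⟨R \ (𝒳.filter fun D => D ⊆ R).image pick, sdiff_subset.trans hRQ, ?_, fun D hD hDA => ?_⟩
  · have h1 := le_card_sdiff ((𝒳.filter fun D => D ⊆ R).image pick) R
    have h2 : ((𝒳.filter fun D => D ⊆ R).image pick).card ≤ m := card_image_le.trans hb
    omega
  · have h1 := mem_sdiff.1 (hDA (hpick D hD))
    exact h1.2 (mem_image.2 ⟨D, mem_filter.2 ⟨hD, hDA.trans sdiff_subset⟩, rfl⟩)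

/-- Sets `A`, `B` separated by a hyperplane such that no hyperplane spanned by `A` meets the convex
hull of `B`. -/
lemma exists_avoiding_pair {α : Type} {d : ℕ} (hd : 1 ≤ d) {v : α → Fin d → ℝ}
    {P : Finset α} (h : GenPos v P) (m s : ℕ) (δ : ℝ) (hδ0 : 0 ≤ δ) (hδ1 : δ ≤ 1)
    (hs : (1 - δ) ^ s * ((((P.card ^ d + 2 * d : ℕ) : ℝ)) ^ d) ^ 2 < 1)
    (hδm : (d + 1) ^ 2 * δ * (2 * m : ℝ) ^ d ≤ m) (hm : 2 * m ≤ P.card - P.card / 2)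
    (hdm : d ≤ 2 * m) :
    ∃ A ⊆ P, ∃ B ⊆ P, ∃ f : (Fin d → ℝ) →ₗ[ℝ] ℝ, (∀ a ∈ A, ∀ b ∈ B, f (v b) < f (v a)) ∧
      m ≤ A.card ∧ P.card / 2 ≤ B.card * ((s + 2 * d) ^ d * 3 ^ (d * (d + 1))) ∧
      ∀ D ⊆ A, D.card = d → ∃ (g : (Fin d → ℝ) →ₗ[ℝ] ℝ) (γ : ℝ), (∀ i ∈ D, g (v i) = γ) ∧
        ∀ b ∈ B, γ < g (v b) := by
  classical
  obtain ⟨f, hf⟩ := h.exists_functional_injOn hd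
  obtain ⟨Lo, hLo, hLoc, hlt⟩ := exists_initial_part (fun i => f (v i)) P hf (P.card / 2)
    (Nat.div_le_self _ _)
  set Hi := P \ Lo with hHi
  have hHiP : Hi ⊆ P := sdiff_subset
  have hHic : Hi.card = P.card - P.card / 2 := by rw [hHi, card_sdiff_of_subset hLo, hLoc]
  have hHiLo : ∀ a ∈ Hi, ∀ b ∈ Lo, f (v b) < f (v a) := fun a ha b hb =>
    hlt b hb a (mem_sdiff.1 ha).1 (mem_sdiff.1 ha).2
  have hLone : Lo.Nonempty := by rw [← card_pos, hLoc]; omega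
  have hkne : (powersetCard d Hi).Nonempty := powersetCard_nonempty.2 (by omega)
  have : Nonempty (powersetCard d Hi) := hkne.to_subtype
  have hplane : ∀ D : powersetCard d Hi, ∃ (g : (Fin d → ℝ) →ₗ[ℝ] ℝ) (γ : ℝ),
      (∀ i ∈ D.1, g (v i) = γ) ∧ ∀ p ∈ P, p ∉ D.1 → g (v p) ≠ γ := fun D =>
    h.exists_hyperplane ((mem_powersetCard.1 D.2).1.trans hHiP) (mem_powersetCard.1 D.2).2
  choose g γ hg1 hg2 using hplane
  have hcardκ : Fintype.card (powersetCard d Hi) = Hi.card.choose d := by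
    rw [Fintype.card_coe, card_powersetCard]
  obtain ⟨B, hB, hBc, X, hX, hXs⟩ := exists_low_crossing_subset hd g γ v Lo hLone
    (fun D p hp => hg2 D p (hLo hp) fun hpD =>
      (mem_sdiff.1 ((mem_powersetCard.1 D.2).1 hpD)).2 hp) δ hδ0 hδ1 s (by
    refine lt_of_le_of_lt (mul_le_mul_of_nonneg_left ?_ (pow_nonneg (by linarith) _)) hs
    have : Fintype.card (powersetCard d Hi) ≤ P.card ^ d := by
      rw [hcardκ]
      exact (Nat.choose_le_pow _ _).trans (Nat.pow_le_pow_left (card_le_card hHiP) _)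
    gcongr)
  rw [hLoc] at hBc
  -- The exceptional hyperplanes, read as `d`-subsets of `Hi`, form the sparse hypergraph; an
  -- independent set spans only hyperplanes that miss the hull of `B`.
  obtain ⟨A, hA, hAm, hAX⟩ := exists_independent_subset hd Hi (X.image Subtype.val) (by
      intro D hD
      obtain ⟨D', -, rfl⟩ := mem_image.1 hD
      exact (mem_powersetCard.1 D'.2).2) ((d + 1) ^ 2 * δ) (by
      rw [card_image_of_injective _ Subtype.val_injective, ← hcardκ, mul_assoc]
      exact hX) (by positivity) m (by omega) hdm hδm
  refine ⟨A, hA.trans hHiP, B, hB.trans hLo, f, fun a ha b hb => hHiLo a (hA ha) b (hB hb), hAm, hBc,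
    fun D hD hDc => ?_⟩
  have hDmem : D ∈ powersetCard d Hi := mem_powersetCard.2 ⟨hD.trans hA, hDc⟩
  have hDX : (⟨D, hDmem⟩ : powersetCard d Hi) ∉ X := fun hmem =>
    hAX D (mem_image.2 ⟨_, hmem, rfl⟩) hD
  have h1 := hg1 ⟨D, hDmem⟩
  rcases hXs _ hDX with hside | hside
  · exact ⟨g ⟨D, hDmem⟩, γ ⟨D, hDmem⟩, h1, hside⟩
  · exact ⟨-g ⟨D, hDmem⟩, -γ ⟨D, hDmem⟩, fun i hi => by simp [h1 i hi],
      fun b hb => by simpa using hside b hb⟩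

/-! ### Lifting and induction on the dimension -/

lemma exists_injective_enum {β : Type} (T : Finset β) (k : ℕ) (hk : k ≤ T.card) :
    ∃ e : Fin k → β, Function.Injective e ∧ ∀ i, e i ∈ T := by
  obtain ⟨T', hT', hc⟩ := exists_subset_card_eq hk
  exact ⟨fun i => ((T'.equivFinOfCardEq hc).symm i).1,
    Subtype.val_injective.comp (Equiv.injective _), fun i => hT' (Subtype.prop _)⟩

/-- A crossing family in a central projection of `A` from `B` lifts to a crossing family. -/
lemma exists_family_of_avoiding_pair {α : Type} {d : ℕ} (hd : 2 ≤ d) {v : α → Fin (d + 1) → ℝ}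
    {P A B : Finset α} (h : GenPos v P) (hA : A ⊆ P) (hB : B ⊆ P)
    (f : (Fin (d + 1) → ℝ) →ₗ[ℝ] ℝ) (hf : ∀ a ∈ A, ∀ b ∈ B, f (v b) < f (v a))
    (hsep : ∀ D ⊆ A, D.card = d + 1 → ∃ (g : (Fin (d + 1) → ℝ) →ₗ[ℝ] ℝ) (γ : ℝ),
      (∀ i ∈ D, g (v i) = γ) ∧ ∀ b ∈ B, γ < g (v b)) (r : ℕ)
    (hF : ∀ v' : α → Fin d → ℝ, GenPos v' A → ∃ F, IsFamily v' A F ∧ r ≤ F.card) (k : ℕ)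
    (hkr : k ≤ r) (hkB : k ≤ B.card) :
    ∃ F, IsFamily v P F ∧ F.card = k := by
  classical
  obtain ⟨b, hbinj, hbB⟩ := exists_injective_enum B k hkB
  have hcross : ∃ s : Fin k → Finset α, (∀ i, s i ⊆ A ∧ (s i).card = d) ∧
      ∀ i j, i ≠ j → Crosses v (insert (b i) (s i)) (insert (b j) (s j)) := by
    rcases Nat.eq_zero_or_pos k with rfl | hk
    · exact ⟨fun i => i.elim0, fun i => i.elim0, fun i => i.elim0⟩
    have hbase : ∀ i, ∃ v' : α → Fin d → ℝ, GenPos v' A ∧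
        ∀ s ⊆ A, ∀ t ⊆ A, Crosses v' s t → ViewCrosses v s t (v (b i)) := fun i =>
      exists_central_projection h hA (hB (hbB i)) f fun a ha => hf a ha _ (hbB i)
    -- The family is found in the projection from one point of `B` only; its crossings are then
    -- carried to the viewpoint `b i` before `b i` and `b j` are added as apexes.
    obtain ⟨v', hv', hview⟩ := hbase ⟨0, hk⟩
    obtain ⟨F, hFam, hFr⟩ := hF v' hv'
    obtain ⟨s, hsinj, hsF⟩ := exists_injective_enum F k (hkr.trans hFr)
    refine ⟨s, fun i => hFam.1 _ (hsF i), fun i j hij => ?_⟩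
    have hc := hFam.2 _ (hsF i) _ (hsF j) (hsinj.ne hij)
    obtain ⟨hi, hic⟩ := hFam.1 _ (hsF i)
    obtain ⟨hj, hjc⟩ := hFam.1 _ (hsF j)
    have hsep2 : ∀ b ∈ B, ∀ b' ∈ B, ∀ D ⊆ A, D.card = d + 1 →
        ∃ (g : (Fin (d + 1) → ℝ) →ₗ[ℝ] ℝ) (γ : ℝ),
          (∀ i ∈ D, g (v i) = γ) ∧ γ < g (v b) ∧ γ < g (v b') := by
      intro b hb b' hb' D hD hDc
      obtain ⟨g, γ, h1, h2⟩ := hsep D hD hDc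
      exact ⟨g, γ, h1, h2 b hb, h2 b' hb'⟩
    have hBA : ∀ b ∈ B, b ∉ A := fun b hb hbA => lt_irrefl _ (hf b hbA b hb)
    have hvi := viewCrosses_of_avoiding (by omega) h hA (hsep2 _ (hbB ⟨0, hk⟩) _ (hbB i)) hi hj hc.1
      (by omega) (by omega) (hview _ hi _ hj hc) 1 (by simp)
    rw [one_smul, add_sub_cancel] at hvi
    exact crosses_insert (by omega) h hA (hB (hbB i)) (hB (hbB j)) (hbinj.ne hij) (hBA _ (hbB i))
      (hBA _ (hbB j)) (hsep2 _ (hbB i) _ (hbB j)) hi hj hc.1 (by omega) (by omega) hvi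
  obtain ⟨s, hs, hc⟩ := hcross
  have hbs : ∀ i, b i ∉ s i := fun i hi => lt_irrefl _ (hf _ ((hs i).1 hi) _ (hbB i))
  refine ⟨univ.image fun i => insert (b i) (s i), ⟨?_, ?_⟩, ?_⟩
  · intro u hu
    obtain ⟨i, -, rfl⟩ := mem_image.1 hu
    exact ⟨insert_subset (hB (hbB i)) ((hs i).1.trans hA), by
      rw [card_insert_of_notMem (hbs i), (hs i).2]⟩
  · intro u hu t ht hut
    obtain ⟨i, -, rfl⟩ := mem_image.1 hu
    obtain ⟨j, -, rfl⟩ := mem_image.1 ht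
    exact hc i j (by rintro rfl; exact hut rfl)
  · rw [card_image_of_injective, card_univ, Fintype.card_fin]
    intro i j hij
    by_contra hne
    have := (hc i j hne).1
    dsimp only at hij
    rw [hij, disjoint_self_iff_empty] at this
    exact insert_ne_empty _ _ this

/-- Every `n > d` points in general position in dimension `d` span a crossing family of size
`Ω(n ^ e)`. -/
def HasCrossingBound (d : ℕ) (e : ℝ) : Prop :=
  ∃ c : ℝ, 0 < c ∧ ∀ (α : Type) (v : α → Fin d → ℝ) (P : Finset α), GenPos v P → d < P.card →
    ∃ F, IsFamily v P F ∧ c * (P.card : ℝ) ^ e ≤ F.card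

lemma hasCrossingBound_two : HasCrossingBound 2 (1 / 2) :=
  ⟨1 / 15, by norm_num, fun α v P h hP => by
    obtain ⟨F, h1, h2⟩ := exists_planar_family v P h hP
    exact ⟨F, h1, by rwa [← Real.sqrt_eq_rpow]⟩⟩

lemma one_le_log_of_three_le {n : ℕ} (hn : 3 ≤ n) : 1 ≤ Real.log n := by
  rw [Real.le_log_iff_exp_le (by positivity)]
  have h1 := Real.exp_one_lt_d9
  have h2 : (3 : ℝ) ≤ n := by exact_mod_cast hn
  linarith

/-- The sampling parameters used for `n` points and target size `m`. -/
lemma exists_sampling_parameters (k : ℕ) (hk : 1 ≤ k) : ∃ C : ℝ, 0 < C ∧ ∀ n m : ℕ, 3 ≤ n → k ≤ n →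
    1 ≤ m → ∃ (s : ℕ) (δ : ℝ), 0 ≤ δ ∧ δ ≤ 1 ∧
      (1 - δ) ^ s * ((((n ^ k + 2 * k : ℕ) : ℝ)) ^ k) ^ 2 < 1 ∧
      (k + 1) ^ 2 * δ * (2 * m : ℝ) ^ k ≤ m ∧
      (((s + 2 * k) ^ k * 3 ^ (k * (k + 1)) : ℕ) : ℝ) ≤
        C * ((m : ℝ) ^ (k - 1) * Real.log n) ^ k := by
  -- With `δ = 1 / (K * m ^ (k - 1))` the sparsity condition `(k + 1) ^ 2 * δ * (2 * m) ^ k ≤ m`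
  -- holds with equality.
  set K : ℝ := (k + 1) ^ 2 * 2 ^ k with hK
  have hK1 : 1 ≤ K := by
    have h1 : (1 : ℝ) ≤ (k + 1) ^ 2 := one_le_pow₀ (by linarith [Nat.cast_nonneg (α := ℝ) k])
    have h2 : (1 : ℝ) ≤ 2 ^ k := one_le_pow₀ (by norm_num)
    nlinarith
  set C₁ : ℝ := 2 * k * (k + 1) * K + 1 + 2 * k with hC₁
  have hC₁0 : 0 < C₁ := by positivity
  refine ⟨C₁ ^ k * 3 ^ (k * (k + 1)), by positivity, fun n m hn hkn hm => ?_⟩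
  have hL := one_le_log_of_three_le hn
  set L := Real.log n with hLdef
  have hm1 : (1 : ℝ) ≤ m := by exact_mod_cast hm
  have hM1 : (1 : ℝ) ≤ (m : ℝ) ^ (k - 1) := one_le_pow₀ hm1
  set M := (m : ℝ) ^ (k - 1) with hM
  have hKM : 1 ≤ K * M := by nlinarith
  refine ⟨⌊2 * k * (k + 1) * L * (K * M)⌋₊ + 1, 1 / (K * M), by positivity, ?_, ?_, ?_, ?_⟩
  · rw [div_le_one (by linarith)]; exact hKM
  · set s := ⌊2 * k * (k + 1) * L * (K * M)⌋₊ + 1 with hs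
    have hslt : 2 * k * (k + 1) * L * (K * M) < s := by
      rw [hs]; push_cast; exact Nat.lt_floor_add_one _
    have hδs : 2 * k * (k + 1) * L < 1 / (K * M) * s := by
      rw [one_div, inv_mul_eq_div, lt_div_iff₀ (by linarith)]; exact hslt
    have hN : n ^ k + 2 * k ≤ n ^ (k + 1) := by
      have h1 : n ≤ n ^ k := Nat.le_self_pow (by omega) n
      have h2 : n ^ (k + 1) = n ^ k * n := pow_succ _ _
      nlinarith
    -- There are at most `n ^ (2 * k * (k + 1))` vertex pairs, and `s` was chosen so that `δ * s`
    -- exceeds the logarithm of this number.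
    have hN' : ((((n ^ k + 2 * k : ℕ) : ℝ)) ^ k) ^ 2 ≤ Real.exp (2 * k * (k + 1) * L) := by
      have h1 : (((n ^ k + 2 * k : ℕ) : ℝ)) ≤ (n : ℝ) ^ (k + 1) := by exact_mod_cast hN
      have h2 : Real.exp (2 * k * (k + 1) * L) = (((n : ℝ) ^ (k + 1)) ^ k) ^ 2 := by
        rw [← pow_mul, ← pow_mul, ← Real.exp_log (show (0 : ℝ) < n by positivity), ← Real.exp_nat_mul,
          ← hLdef]
        push_cast; congr 1; ring
      rw [h2]
      gcongr
    have hbase : (1 - 1 / (K * M)) ^ s ≤ Real.exp (-(1 / (K * M) * s)) := by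
      have h1 : 1 - 1 / (K * M) ≤ Real.exp (-(1 / (K * M))) := by
        linarith [Real.add_one_le_exp (-(1 / (K * M)))]
      have h0 : 0 ≤ 1 - 1 / (K * M) := by
        rw [sub_nonneg, div_le_one (by linarith)]; exact hKM
      calc (1 - 1 / (K * M)) ^ s ≤ Real.exp (-(1 / (K * M))) ^ s := pow_le_pow_left₀ h0 h1 s
        _ = _ := by rw [← Real.exp_nat_mul]; congr 1; ring
    calc (1 - 1 / (K * M)) ^ s * ((((n ^ k + 2 * k : ℕ) : ℝ)) ^ k) ^ 2
        ≤ Real.exp (-(1 / (K * M) * s)) * Real.exp (2 * k * (k + 1) * L) := by gcongr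
      _ < 1 := by rw [← Real.exp_add, Real.exp_lt_one_iff]; linarith
  · have hmk : (m : ℝ) ^ k = M * m := by rw [hM, ← pow_succ, Nat.sub_add_cancel hk]
    rw [mul_pow, hmk]
    apply le_of_eq
    rw [hK]
    field_simp
  · have hs : ((⌊2 * k * (k + 1) * L * (K * M)⌋₊ + 1 + 2 * k : ℕ) : ℝ) ≤ C₁ * (M * L) := by
      push_cast
      have h1 : (⌊2 * k * (k + 1) * L * (K * M)⌋₊ : ℝ) ≤ 2 * k * (k + 1) * L * (K * M) :=
        Nat.floor_le (by positivity)
      have h2 : 1 ≤ M * L := by nlinarith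
      have h3 : (1 + 2 * k : ℝ) * 1 ≤ (1 + 2 * k) * (M * L) := by gcongr
      rw [hC₁]
      nlinarith
    push_cast at hs ⊢
    calc (⌊2 * (k : ℝ) * (k + 1) * L * (K * M)⌋₊ + 1 + 2 * (k : ℝ)) ^ k * 3 ^ (k * (k + 1))
        ≤ (C₁ * (M * L)) ^ k * 3 ^ (k * (k + 1)) := by gcongr
      _ = _ := by rw [mul_pow]; ring

lemma eventually_log_pow_le (C : ℝ) (k : ℕ) (t : ℝ) (ht : 0 < t) :
    ∀ᶠ n : ℕ in Filter.atTop, C * Real.log n ^ k ≤ (n : ℝ) ^ t := by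
  have h1 := (isLittleO_log_rpow_rpow_atTop (k : ℝ) ht).def
    (show (0 : ℝ) < 1 / (|C| + 1) by positivity)
  have h2 := tendsto_natCast_atTop_atTop.eventually (h1.and (Filter.eventually_ge_atTop (1 : ℝ)))
  filter_upwards [h2] with n hn
  obtain ⟨hn1, hn2⟩ := hn
  have hlog : 0 ≤ Real.log n := Real.log_nonneg hn2
  rw [Real.rpow_natCast, Real.norm_of_nonneg (by positivity), Real.norm_of_nonneg (by positivity),
    one_div, inv_mul_eq_div, le_div_iff₀ (by positivity)] at hn1
  have h3 : 0 ≤ Real.log n ^ k := by positivity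
  nlinarith [le_abs_self C]

/-- For `x = n ^ (1 / D)` and `m = ⌊x⌋`, the cutting uses up a factor of order `x ^ (d * (d + 1)) *
(log n) ^ (d + 1)` of `n = x ^ (d * (d + 1) + 1)`. So `B` keeps about `x / (log n) ^ (d + 1)`
points, which is at least `x ^ e` for large `n` because `e < 1`. The projection of `A` supplies a
family of order `x ^ e`. -/
lemma HasCrossingBound.succ {d : ℕ} (hd : 2 ≤ d) {e : ℝ} (he0 : 0 < e) (he : e ≤ 1 / 2)
    (h : HasCrossingBound d e) :
    HasCrossingBound (d + 1) (e / (((d + 1 : ℕ) : ℝ) ^ 2 - ((d + 1 : ℕ) : ℝ) + 1)) := by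
  classical
  obtain ⟨c', hc', hfam⟩ := h
  obtain ⟨C, hC, hpar⟩ := exists_sampling_parameters (d + 1) (by omega)
  set D : ℕ := d * (d + 1) + 1 with hD
  have hDe : ((d + 1 : ℕ) : ℝ) ^ 2 - ((d + 1 : ℕ) : ℝ) + 1 = (D : ℝ) := by
    rw [hD]; push_cast; ring
  rw [hDe]
  have hD0 : (0 : ℝ) < D := by positivity
  have hD1 : (1 : ℝ) ≤ D := by rw [hD]; push_cast; nlinarith [Nat.cast_nonneg (α := ℝ) d]
  have hev1 := eventually_log_pow_le (3 * C) (d + 1) ((1 - e) / D) (div_pos (by linarith) hD0)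
  have hev2 : ∀ᶠ n : ℕ in Filter.atTop, (d + 6 : ℝ) ≤ (n : ℝ) ^ (1 / (D : ℝ)) :=
    ((tendsto_rpow_atTop (one_div_pos.2 hD0)).comp tendsto_natCast_atTop_atTop).eventually
      (Filter.eventually_ge_atTop _)
  obtain ⟨N, hN⟩ := Filter.eventually_atTop.1 (hev1.and hev2)
  -- The entries serve the family in the projection of `A`, the supply of apexes in `B`, and the
  -- finitely many `n < N`, where a single simplex suffices.
  refine ⟨min (min (c' / 2) 1) (1 / (N + 1)), by positivity, fun α v P hP hcard => ?_⟩
  set n := P.card with hn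
  have hn1 : (1 : ℝ) ≤ n := by
    have : 1 ≤ n := by omega
    exact_mod_cast this
  by_cases hnN : n < N
  · obtain ⟨s, hs, hsc⟩ := exists_subset_card_eq hcard.le
    refine ⟨{s}, IsFamily.singleton v hs hsc, ?_⟩
    have h1 : (n : ℝ) ^ (e / D) ≤ n := by
      conv_rhs => rw [← Real.rpow_one (n : ℝ)]
      refine Real.rpow_le_rpow_of_exponent_le hn1 ?_
      rw [div_le_one hD0]; linarith
    have h2 : (n : ℝ) ≤ N := by exact_mod_cast hnN.le
    calc min (min (c' / 2) 1) (1 / ((N : ℝ) + 1)) * (n : ℝ) ^ (e / D)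
        ≤ 1 / ((N : ℝ) + 1) * N := by
          gcongr
          · exact min_le_right _ _
          · exact h1.trans h2
      _ ≤ 1 := by rw [one_div, inv_mul_eq_div, div_le_one (by positivity)]; linarith
      _ = _ := by simp
  obtain ⟨hlog, hx⟩ := hN n (not_lt.1 hnN)
  set x : ℝ := (n : ℝ) ^ (1 / (D : ℝ)) with hxdef
  have hx0 : 0 < x := by linarith [Nat.cast_nonneg (α := ℝ) d]
  have hxD : x ^ D = n := by
    rw [hxdef, ← Real.rpow_natCast, ← Real.rpow_mul (by positivity), one_div,
      inv_mul_cancel₀ hD0.ne', Real.rpow_one]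
  have hxt : ∀ t : ℝ, (n : ℝ) ^ (t / D) = x ^ t := fun t => by
    rw [hxdef, ← Real.rpow_mul (by positivity)]; congr 1; ring
  rw [hxt] at hlog ⊢
  set m := ⌊x⌋₊ with hm
  have hmx : (m : ℝ) ≤ x := Nat.floor_le hx0.le
  have hxm : x < m + 1 := Nat.lt_floor_add_one x
  clear hxt hN
  clear_value m x D
  have hdm : d + 5 ≤ m := by
    have : (d + 6 : ℝ) < m + 1 := by linarith
    have : d + 6 < m + 1 := by exact_mod_cast this
    omega
  have hmn : 4 * m ≤ n := by
    have h1 : x ^ 2 ≤ x ^ D := pow_le_pow_right₀ (by linarith [Nat.cast_nonneg (α := ℝ) d])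
      (by rw [hD]; nlinarith)
    have h2 : (4 * m : ℝ) ≤ n := by
      rw [← hxD]; nlinarith [Nat.cast_nonneg (α := ℝ) d]
    exact_mod_cast h2
  obtain ⟨s, δ, hδ0, hδ1, hs, hδm, hsC⟩ := hpar n m (by omega) (by omega) (by omega)
  obtain ⟨A, hA, B, hB, f, hf, hAm, hBc, hsep⟩ := exists_avoiding_pair (by omega) hP m s δ hδ0 hδ1 hs
    hδm (by omega) (by omega)
  have hL := one_le_log_of_three_le (show 3 ≤ n by omega)
  generalize Real.log n = ℓ at hL hlog hsC
  have hℓ : 0 < ℓ := by linarith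
  have hBx : x ^ e ≤ B.card := by
    have h1 : ((n / 2 : ℕ) : ℝ) ≤ B.card * (C * ((m : ℝ) ^ d * ℓ) ^ (d + 1)) := by
      calc ((n / 2 : ℕ) : ℝ)
          ≤ B.card * (((s + 2 * (d + 1)) ^ (d + 1) * 3 ^ ((d + 1) * (d + 1 + 1)) : ℕ) : ℝ) := by
            exact_mod_cast hBc
        _ ≤ _ := by gcongr; exact hsC
    have h2 : (n : ℝ) / 3 ≤ ((n / 2 : ℕ) : ℝ) := by
      have : n ≤ 3 * (n / 2) := by omega
      have : (n : ℝ) ≤ 3 * ((n / 2 : ℕ) : ℝ) := by exact_mod_cast this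
      linarith
    have h3 : (m : ℝ) ^ (d * (d + 1)) ≤ x ^ (d * (d + 1)) := by gcongr
    have h4 : x ^ D = x ^ (d * (d + 1)) * x := by rw [hD, pow_succ]
    rw [← hxD, h4] at h2
    clear h4
    rw [mul_pow, ← pow_mul] at h1
    have hpos : 0 < x ^ (d * (d + 1)) := by positivity
    have h5 : x ^ (d * (d + 1)) * x ≤
        x ^ (d * (d + 1)) * (B.card * (3 * C * ℓ ^ (d + 1))) := by
      have : (B.card : ℝ) * (C * ((m : ℝ) ^ (d * (d + 1)) * ℓ ^ (d + 1))) ≤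
          B.card * (C * (x ^ (d * (d + 1)) * ℓ ^ (d + 1))) :=
        mul_le_mul_of_nonneg_left (mul_le_mul_of_nonneg_left
          (mul_le_mul_of_nonneg_right h3 (pow_pos hℓ _).le) hC.le) (Nat.cast_nonneg _)
      nlinarith
    have h6 : x ≤ B.card * x ^ (1 - e) :=
      (le_of_mul_le_mul_left h5 hpos).trans (mul_le_mul_of_nonneg_left hlog (Nat.cast_nonneg _))
    have h7 : x ^ e * x ^ (1 - e) = x := by
      rw [← Real.rpow_add hx0]; simp
    exact le_of_mul_le_mul_right (h7.trans_le h6) (by positivity)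
  obtain ⟨F, hF, hFc⟩ := exists_family_of_avoiding_pair hd hP hA hB f hf hsep ⌈c' / 2 * x ^ e⌉₊
    (fun v' hv' => by
      obtain ⟨F, hF, hFc⟩ := hfam α v' A hv' (by omega)
      refine ⟨F, hF, Nat.ceil_le.2 (le_trans ?_ hFc)⟩
      have h1 : x / 2 ≤ A.card := by
        have : (m : ℝ) ≤ A.card := by exact_mod_cast hAm
        linarith [Nat.cast_nonneg (α := ℝ) d]
      have h2 : (1 / 2 : ℝ) * x ^ e ≤ (A.card : ℝ) ^ e := by
        calc (1 / 2 : ℝ) * x ^ e ≤ (1 / 2 : ℝ) ^ e * x ^ e := by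
              gcongr
              exact Real.self_le_rpow_of_le_one (by norm_num) (by norm_num) (by linarith)
          _ = (x / 2) ^ e := by rw [← Real.mul_rpow (by norm_num) hx0.le]; congr 1; ring
          _ ≤ _ := by gcongr
      nlinarith) (min ⌈c' / 2 * x ^ e⌉₊ B.card) (min_le_left _ _) (min_le_right _ _)
  refine ⟨F, hF, ?_⟩
  rw [hFc, Nat.cast_min]
  have hxe : 0 < x ^ e := by positivity
  refine le_min ?_ ?_
  · refine le_trans ?_ (Nat.le_ceil _)
    gcongr
    exact (min_le_left _ _).trans (min_le_left _ _)
  · refine le_trans ?_ hBx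
    exact mul_le_of_le_one_left hxe.le ((min_le_left _ _).trans (min_le_right _ _))

lemma hasCrossingBound (d : ℕ) (hd : 2 ≤ d) :
    HasCrossingBound d ((1 : ℝ) / (2 * ∏ i ∈ Icc 3 d, ((i : ℝ) ^ 2 - (i : ℝ) + 1))) := by
  induction d, hd using Nat.le_induction with
  | base => simpa using hasCrossingBound_two
  | succ d hd ih =>
    have hprod : 1 ≤ ∏ i ∈ Icc 3 d, ((i : ℝ) ^ 2 - (i : ℝ) + 1) := by
      refine prod_const_one.symm.trans_le (prod_le_prod (s := Icc 3 d) (f := fun _ => (1 : ℝ))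
        (fun _ _ => zero_le_one) fun i hi => ?_)
      have : (3 : ℝ) ≤ i := by exact_mod_cast (mem_Icc.1 hi).1
      nlinarith
    have := ih.succ hd (by positivity) (by
      rw [div_le_div_iff₀ (by positivity) (by norm_num)]; linarith)
    rw [prod_Icc_succ_top (by omega), ← mul_assoc, ← div_div]
    exact this

/-! ### Back to Euclidean space and simplices -/

/-- Extend `S` to `d + 1` points `T` of `P`, which is where `d < P.card` is needed. If `T` is
affinely dependent, affine functionals cannot take arbitrary values on it; both spaces have
dimension `d + 1`, so some nonzero affine functional vanishes on `T`, and its zero set is a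
forbidden hyperplane. -/
lemma genPos_of_inGeneralPosition {d : ℕ} {P : Finset (EuclideanSpace ℝ (Fin d))}
    (h : InGeneralPosition P) (hP : d < P.card) :
    GenPos (fun x : EuclideanSpace ℝ (Fin d) => x.ofLp) P := by
  classical
  intro S hS hSc w hw0 hw1 i₀ hi₀
  obtain ⟨T, hST, hTP, hTc⟩ := exists_subsuperset_card_eq hS hSc hP
  by_contra hne
  let E := EuclideanSpace ℝ (Fin d)
  let L : ((E × ℝ) →ₗ[ℝ] ℝ) →ₗ[ℝ] (T → ℝ) :=
    LinearMap.pi fun i => LinearMap.applyₗ (R := ℝ) (M₂ := ℝ) ((i.1, 1) : E × ℝ)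
  have hw1' : ∑ i ∈ S, w i • i = 0 := by
    have := congrArg (WithLp.toLp 2) hw1
    simpa [WithLp.toLp_sum] using this
  have hsum : ∑ i ∈ S, w i • ((i, 1) : E × ℝ) = 0 := by
    ext1
    · simpa [Prod.fst_sum] using hw1'
    · simpa [Prod.snd_sum] using hw0
  have hker : LinearMap.ker L ≠ ⊥ := by
    intro hbot
    have hinj := LinearMap.ker_eq_bot.1 hbot
    have hfr : Module.finrank ℝ ((E × ℝ) →ₗ[ℝ] ℝ) = Module.finrank ℝ (T → ℝ) := by
      rw [Module.finrank_linearMap]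
      simp [E, hTc]
    obtain ⟨G, hG⟩ := (LinearMap.injective_iff_surjective_of_finrank_eq_finrank hfr).1 hinj
      (Pi.single ⟨i₀, hST hi₀⟩ 1)
    have hGi : ∀ i : T, G (i.1, 1) = Pi.single (M := fun _ => ℝ) ⟨i₀, hST hi₀⟩ 1 i :=
      fun i => congrFun hG i
    have h1 := congrArg G hsum
    rw [map_sum, map_zero, sum_eq_single i₀, map_smul, hGi ⟨i₀, hST hi₀⟩, Pi.single_eq_same,
      smul_eq_mul, mul_one] at h1
    · exact hne h1
    · intro j hj hji
      rw [map_smul, hGi ⟨j, hST hj⟩, Pi.single_eq_of_ne (by simpa using hji), smul_zero]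
    · intro hn; exact absurd hi₀ hn
  obtain ⟨G, hG, hG0⟩ := (Submodule.ne_bot_iff _).1 hker
  have hGT : ∀ x ∈ T, G (x, 1) = 0 := fun x hx => congrFun (LinearMap.mem_ker.1 hG) ⟨x, hx⟩
  have hsplit : ∀ (x : E) (r : ℝ), G (x, r) = G (x, 0) + r * G (0, 1) := fun x r => by
    rw [← smul_eq_mul, ← map_smul, ← map_add]; simp
  set g : E →ₗ[ℝ] ℝ := G.comp (LinearMap.inl ℝ E ℝ) with hg
  have hgv : ∀ x, g x = G (x, 0) := fun x => rfl
  have hg0 : g ≠ 0 := by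
    intro h0
    have h1 : ∀ x, G (x, 0) = 0 := fun x => by rw [← hgv, h0]; rfl
    have h2 := hGT i₀ (hST hi₀)
    rw [hsplit, h1, zero_add, one_mul] at h2
    refine hG0 (LinearMap.ext fun z => ?_)
    rw [show z = (z.1, z.2) from rfl, hsplit, h1, h2]
    simp
  refine h T hTP hTc ⟨AffineSubspace.mk' i₀ (LinearMap.ker g), ⟨i₀, AffineSubspace.self_mem_mk' _ _⟩,
    ?_, fun x hx => ?_⟩
  · rw [AffineSubspace.direction_mk', Module.Dual.finrank_ker_add_one_of_ne_zero hg0]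
    simp [E]
  · rw [SetLike.mem_coe, AffineSubspace.mem_mk', LinearMap.mem_ker, vsub_eq_sub, map_sub]
    have h1 := hGT x hx
    have h2 := hGT i₀ (hST hi₀)
    rw [hsplit] at h1 h2
    rw [hgv, hgv]
    linarith

/-- A family of pairwise crossing vertex sets yields a crossing family of simplices. -/
lemma exists_isCrossingFamily {d : ℕ} (hd : 2 ≤ d) {P : Finset (EuclideanSpace ℝ (Fin d))}
    (h : GenPos (fun x : EuclideanSpace ℝ (Fin d) => x.ofLp) P)
    {F : Finset (Finset (EuclideanSpace ℝ (Fin d)))}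
    (hF : IsFamily (fun x : EuclideanSpace ℝ (Fin d) => x.ofLp) P F) :
    ∃ F' : Finset (Affine.Simplex ℝ (EuclideanSpace ℝ (Fin d)) (d - 1)),
      IsCrossingFamily P F' ∧ F'.card = F.card := by
  classical
  have hsimp : ∀ s ∈ F, ∃ σ : Affine.Simplex ℝ (EuclideanSpace ℝ (Fin d)) (d - 1),
      Set.range σ.points = (s : Set (EuclideanSpace ℝ (Fin d))) := by
    intro s hs
    obtain ⟨hsP, hsc⟩ := hF.1 s hs
    let e := s.equivFinOfCardEq (show s.card = d - 1 + 1 by omega)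
    refine ⟨⟨fun i => (e.symm i).1, ?_⟩, ?_⟩
    · have : AffineIndependent ℝ (fun x : s => (x : EuclideanSpace ℝ (Fin d))) := by
        rw [affineIndependent_iff]
        intro t w hw0 hw1 x hx
        set w' : EuclideanSpace ℝ (Fin d) → ℝ :=
          fun y => if hy : y ∈ s then w ⟨y, hy⟩ else 0 with hw'
        have hw'x : ∀ y : s, w' y = w y := fun y => by simp [hw']
        have := h (t.map (Function.Embedding.subtype _)) (fun y hy => by
            obtain ⟨z, -, rfl⟩ := mem_map.1 hy
            exact hsP z.2) (by
            rw [card_map]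
            have := card_le_univ t
            rw [Fintype.card_coe] at this
            omega) w' (by
            rw [sum_map]
            simpa [hw'x] using hw0) (by
            rw [sum_map]
            have := congrArg WithLp.ofLp hw1
            simpa [hw'x, WithLp.ofLp_sum] using this) x (mem_map_of_mem _ hx)
        rwa [← hw'x x]
      exact this.comp_embedding e.symm.toEmbedding
    · ext x
      simp only [Set.mem_range, mem_coe]
      constructor
      · rintro ⟨i, rfl⟩; exact (e.symm i).2
      · intro hx; exact ⟨e ⟨x, hx⟩, by simp⟩
  rcases F.eq_empty_or_nonempty with rfl | ⟨s₀, hs₀⟩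
  · exact ⟨∅, ⟨by simp, by simp⟩, rfl⟩
  have : Nonempty (Affine.Simplex ℝ (EuclideanSpace ℝ (Fin d)) (d - 1)) :=
    (hsimp s₀ hs₀).nonempty
  choose! σ hσ using hsimp
  have hsumσ : ∀ s ∈ F, ∀ {M : Type} [AddCommMonoid M] (f : EuclideanSpace ℝ (Fin d) → M),
      ∑ i, f ((σ s).points i) = ∑ x ∈ s, f x := by
    intro s hs M _ f
    have hinj := (σ s).independent.injective
    rw [← sum_image (f := f) (s := univ) (g := (σ s).points) (fun i _ j _ hij => hinj hij)]
    congr 1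
    rw [← coe_inj, coe_image, coe_univ, Set.image_univ, hσ s hs]
  have hint : ∀ s ∈ F, ∀ (w : EuclideanSpace ℝ (Fin d) → ℝ) (r : ℝ), (∀ x ∈ s, 0 < w x) →
      ∑ x ∈ s, w x = r → 0 < r → r⁻¹ • ∑ x ∈ s, w x • x ∈ (σ s).interior := by
    intro s hs w r hw hr hr0
    have hmem : ∀ i, (σ s).points i ∈ s := fun i => by
      rw [← mem_coe, ← hσ s hs]; exact ⟨i, rfl⟩
    set w' : Fin (d - 1 + 1) → ℝ := fun i => r⁻¹ * w ((σ s).points i) with hw'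
    have hw'0 : ∀ i, 0 < w' i := fun i => mul_pos (inv_pos.2 hr0) (hw _ (hmem i))
    have hw'1 : ∑ i, w' i = 1 := by
      rw [hw', ← mul_sum, hsumσ s hs w, hr, inv_mul_cancel₀ hr0.ne']
    have hcomb : Finset.univ.affineCombination ℝ (σ s).points w' = r⁻¹ • ∑ x ∈ s, w x • x := by
      rw [Finset.affineCombination_eq_linear_combination _ _ _ hw'1,
        ← hsumσ s hs (fun x => w x • x), smul_sum]
      exact sum_congr rfl fun i _ => by rw [smul_smul]
    rw [← hcomb]
    refine (Affine.Simplex.affineCombination_mem_setInterior_iff hw'1).2 fun i => ⟨hw'0 i, ?_⟩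
    -- The interior also demands weights below `1`; this follows from the positive weight of a
    -- second vertex, available since `2 ≤ d`.
    obtain ⟨j, hj⟩ : ∃ j : Fin (d - 1 + 1), j ≠ i := by
      have : Nontrivial (Fin (d - 1 + 1)) := Fin.nontrivial_iff_two_le.2 (by omega)
      exact exists_ne i
    rw [← hw'1, ← add_sum_erase univ w' (mem_univ i)]
    have : w' j ≤ ∑ k ∈ univ.erase i, w' k :=
      single_le_sum (fun k _ => (hw'0 k).le) (mem_erase.2 ⟨hj, mem_univ j⟩)
    linarith [hw'0 j]
  have hcross : ∀ s ∈ F, ∀ t ∈ F, s ≠ t → StronglyCross (σ s) (σ t) := by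
    intro s hs t ht hst
    obtain ⟨hdis, w, h1, h2, h3, h4⟩ := hF.2 s hs t ht hst
    have hpos : 0 < ∑ x ∈ s, w x := sum_pos h1 (card_pos.1 (by rw [(hF.1 s hs).2]; omega))
    refine ⟨⟨_, hint s hs w _ h1 rfl hpos, ?_⟩, ?_⟩
    · have h4' : ∑ x ∈ s, w x • x = ∑ x ∈ t, w x • x := by
        have := congrArg (WithLp.toLp 2) h4
        simpa [WithLp.toLp_sum] using this
      rw [h4']
      exact hint t ht w _ h2 h3.symm hpos
    · rw [hσ s hs, hσ t ht]
      exact disjoint_coe.2 hdis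
  refine ⟨F.image σ, ⟨?_, ?_⟩, card_image_of_injOn fun s hs t ht hst => ?_⟩
  · intro τ hτ i
    obtain ⟨s, hs, rfl⟩ := mem_image.1 hτ
    have : (σ s).points i ∈ (s : Set (EuclideanSpace ℝ (Fin d))) := by
      rw [← hσ s hs]; exact ⟨i, rfl⟩
    exact (hF.1 s hs).1 this
  · intro τ hτ τ' hτ' hne
    obtain ⟨s, hs, rfl⟩ := mem_image.1 hτ
    obtain ⟨t, ht, rfl⟩ := mem_image.1 hτ'
    exact hcross s hs t ht (by rintro rfl; exact hne rfl)
  · rw [mem_coe] at hs ht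
    rw [← coe_inj, ← hσ s hs, ← hσ t ht, hst]

theorem corollary3p4 :
    (∃ c : ℝ, 0 < c ∧
      ∀ P : Finset (EuclideanSpace ℝ (Fin 2)), InGeneralPosition P → 2 < P.card →
        ∃ F : Finset (Affine.Simplex ℝ (EuclideanSpace ℝ (Fin 2)) (2 - 1)),
          IsCrossingFamily P F ∧ c * Real.sqrt (P.card : ℝ) ≤ (F.card : ℝ)) ∧
    (∀ d : ℕ, 3 ≤ d → ∃ c : ℝ, 0 < c ∧
      ∀ P : Finset (EuclideanSpace ℝ (Fin d)), InGeneralPosition P → d < P.card →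
        ∃ F : Finset (Affine.Simplex ℝ (EuclideanSpace ℝ (Fin d)) (d - 1)),
          IsCrossingFamily P F ∧
          c * (P.card : ℝ) ^
              ((1 : ℝ) / (2 * ∏ i ∈ Finset.Icc 3 d, ((i : ℝ) ^ 2 - (i : ℝ) + 1))) ≤
            (F.card : ℝ)) := by
  constructor
  · refine ⟨1 / 15, by norm_num, fun P hP hc => ?_⟩
    have hgp := genPos_of_inGeneralPosition hP hc
    obtain ⟨F, hF, hFc⟩ := exists_planar_family _ P hgp hc
    obtain ⟨F', hF', hcard⟩ := exists_isCrossingFamily le_rfl hgp hF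
    exact ⟨F', hF', by rw [hcard]; exact hFc⟩
  · intro d hd
    obtain ⟨c, hc0, hc⟩ := hasCrossingBound d (by omega)
    refine ⟨c, hc0, fun P hP hPc => ?_⟩
    have hgp := genPos_of_inGeneralPosition hP hPc
    obtain ⟨F, hF, hFc⟩ := hc _ _ P hgp hPc
    obtain ⟨F', hF', hcard⟩ := exists_isCrossingFamily (by omega) hgp hF
    exact ⟨F', hF', by rw [hcard]; exact hFc⟩
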